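/- For $1\le p\le\infty$ let $L^p_+(\mathbb{R})$ be the space of complex-valued $f\in L^p(\mathbb{R})$ whose distributional Fourier transform is supported in $[0,\infty)$, and let $\Pi$ be the orthogonal projection of $L^2(\mathbb{R})$ onto $L^2_+(\mathbb{R})$. Let $u\in L^2(\mathbb{R})$ be real-valued with $\langle x\rangle u\in L^2(\mathbb{R})$, where $\langle x\rangle=(1+x^2)^{1/2}$. For $m\in L^\infty_+(\mathbb{R})$ put $L_um=-\mathrm{i}\,\partial_x m-\Pi(um)$, where $\partial_x$ is taken in the sense of distributions. Then, for every $\lambda>0$, the complex vector space $$\mathscr M(u,\lambda):=\{m\in L^\infty_+(\mathbb{R}) : (L_u-\lambda)m=0\}$$ is one-dimensional. Moreover, every $m\in\mathscr M(u,\lambda)$ has a continuous representative, for which both limits $$\ell_\pm(m,\lambda)=\lim_{x\to\pm\infty}m(x)\,\mathrm{e}^{-\mathrm{i}\lambda x}$$ exist, and $\ell_+(\cdot,\lambda)$ and $\ell_-(\cdot,\lambda)$ are linear forms on $\mathscr M(u,\lambda)$ that are not identically zero. -/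

import Mathlib

open MeasureTheory Filter Topology
open scoped SchwartzMap FourierTransform ENNReal

noncomputable section

namespace BenjaminOno

/-- The space `L^p_+(ℝ)` of complex-valued `L^p` functions on `ℝ` whose (distributional) Fourier
transform is supported in `[0, ∞)`, that is, vanishes on every Schwartz function supported in
`(-∞, 0)`. Mathlib's Fourier transform has the kernel `exp (-2πi x ξ)`; the rescaling of the
frequency does not change the half-line. -/
def hardy (p : ℝ≥0∞) [Fact (1 ≤ p)] : Submodule ℂ (Lp ℂ p (volume : Measure ℝ)) where
  carrier := {f | Distribution.IsVanishingOn
    (𝓕 (Lp.toTemperedDistribution f : 𝓢'(ℝ, ℂ)) : 𝓢'(ℝ, ℂ)) (Set.Iio (0 : ℝ))}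
  zero_mem' := by
    intro g _
    have h := (Lp.toTemperedDistributionCLM ℂ (volume : Measure ℝ) p).map_zero
    rw [Lp.toTemperedDistributionCLM_apply] at h
    rw [TemperedDistribution.fourier_apply, h, zero_apply]
  add_mem' := by
    intro f₁ f₂ h₁ h₂ g hg
    have e₁ := h₁ g hg
    have e₂ := h₂ g hg
    have h := (Lp.toTemperedDistributionCLM ℂ (volume : Measure ℝ) p).map_add f₁ f₂
    simp only [Lp.toTemperedDistributionCLM_apply] at h
    rw [TemperedDistribution.fourier_apply] at e₁ e₂ ⊢
    rw [h, add_apply, e₁, e₂, add_zero]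
  smul_mem' := by
    intro c f h₁ g hg
    have e₁ := h₁ g hg
    have h := (Lp.toTemperedDistributionCLM ℂ (volume : Measure ℝ) p).map_smul c f
    simp only [Lp.toTemperedDistributionCLM_apply] at h
    rw [TemperedDistribution.fourier_apply] at e₁ ⊢
    rw [h, smul_apply, e₁, smul_zero]

theorem isClosed_hardy (p : ℝ≥0∞) [Fact (1 ≤ p)] :
    IsClosed (hardy p : Set (Lp ℂ p (volume : Measure ℝ))) := by
  have h : (hardy p : Set (Lp ℂ p (volume : Measure ℝ))) =
      ⋂ (g : 𝓢(ℝ, ℂ)) (_ : tsupport g ⊆ Set.Iio (0 : ℝ)),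
        {f | (Lp.toTemperedDistributionCLM ℂ (volume : Measure ℝ) p f) (𝓕 g) = 0} := by
    ext f
    simp only [Set.mem_iInter]
    rfl
  rw [h]
  refine isClosed_iInter fun g => isClosed_iInter fun _ => isClosed_eq ?_ continuous_const
  exact (PointwiseConvergenceCLM.evalCLM (RingHom.id ℂ) ℂ (𝓕 g)).continuous.comp
    (Lp.toTemperedDistributionCLM ℂ (volume : Measure ℝ) p).continuous

instance : CompleteSpace (hardy 2) := (isClosed_hardy 2).completeSpace_coe

/-- The Szegő projection `Π`: the orthogonal projection of `L²(ℝ)` onto `L²_+(ℝ)`. -/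
def szego : Lp ℂ 2 (volume : Measure ℝ) →L[ℂ] Lp ℂ 2 (volume : Measure ℝ) :=
  (hardy 2).starProjection

theorem smul_comm_real (u : Lp ℝ 2 (volume : Measure ℝ)) (c : ℂ)
    (m : Lp ℂ ∞ (volume : Measure ℝ)) :
    (u • (c • m) : Lp ℂ 2 (volume : Measure ℝ)) = c • (u • m : Lp ℂ 2 (volume : Measure ℝ)) := by
  apply Lp.ext
  filter_upwards [Lp.coeFn_lpSMul (r := 2) u (c • m), Lp.coeFn_lpSMul (r := 2) u m,
    Lp.coeFn_smul c m, Lp.coeFn_smul c (u • m : Lp ℂ 2 (volume : Measure ℝ))] with x h₁ h₂ h₃ h₄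
  rw [h₁, h₄, Pi.smul_apply', h₃, Pi.smul_apply, Pi.smul_apply, h₂, Pi.smul_apply', smul_comm]

/-- The Toeplitz operator `T_u m = Π (u m)` with real symbol `u ∈ L²(ℝ)`, acting on
`m ∈ L^∞_+(ℝ)`; here `u • m` is the pointwise product, an element of `L²(ℝ)`. -/
def toeplitz (u : Lp ℝ 2 (volume : Measure ℝ)) :
    hardy ∞ →ₗ[ℂ] Lp ℂ 2 (volume : Measure ℝ) where
  toFun m := szego (u • (m : Lp ℂ ∞ (volume : Measure ℝ)) : Lp ℂ 2 (volume : Measure ℝ))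
  map_add' m₁ m₂ := by
    rw [Submodule.coe_add, Lp.add_smul, map_add]
  map_smul' c m := by
    rw [Submodule.coe_smul, smul_comm_real, map_smul, RingHom.id_apply]

/-- The inclusion of `L^∞_+(ℝ)` in the tempered distributions. -/
def hardyToDistribution : hardy ∞ →ₗ[ℂ] 𝓢'(ℝ, ℂ) :=
  (Lp.toTemperedDistributionCLM ℂ (volume : Measure ℝ) ∞).toLinearMap ∘ₗ (hardy ∞).subtype

/-- The Lax operator `L_u = -i ∂ₓ - T_u` on `L^∞_+(ℝ)`, in the sense of distributions. -/
def lax (u : Lp ℝ 2 (volume : Measure ℝ)) : hardy ∞ →ₗ[ℂ] 𝓢'(ℝ, ℂ) :=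
  (-Complex.I) • ((TemperedDistribution.derivCLM ℂ).toLinearMap ∘ₗ hardyToDistribution)
    - (Lp.toTemperedDistributionCLM ℂ (volume : Measure ℝ) 2).toLinearMap ∘ₗ toeplitz u

/-- The space `ℳ(u, lam) = {m ∈ L^∞_+(ℝ) : (L_u - lam) m = 0}`. -/
def genEigenspace (u : Lp ℝ 2 (volume : Measure ℝ)) (lam : ℝ) : Submodule ℂ (hardy ∞) :=
  LinearMap.ker (lax u - (lam : ℂ) • hardyToDistribution)

end BenjaminOno

end

/-! Put `g = u m`. Since `⟨x⟩ u ∈ L²` and `m` is bounded, `g ∈ L¹ ∩ L²` and `x g ∈ L²`. The equation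
`-i m' - lam m = Π g` can be integrated explicitly. Writing `Π g = g - (1 - Π) g`, its solutions are
`m = V + N`, where `V = exp (i lam x) a`, `a(x) = c + i ∫_{-∞}^x exp (-i lam y) g(y) dy`, and `N`
has Fourier transform `1_{ξ<0} (lam - 2πξ)⁻¹ ĝ`. Because `lam > 0`, the symbol `2πξ - lam` has no
zero on `ξ < 0`. Hence the multiplier is bounded and square integrable, `N` is continuous and tends
to `0` at both ends, and `V + N` automatically has no negative frequencies. This gives the
fixed-point description `mem_genEigenspace_iff`; the limits of `m exp (-i lam x)` at `-∞` and `+∞`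
are `c` and `a(+∞)`.

Two facts use that `u` is real, so that `g conj(m) = u |m|²` is real. The first is conservation of
modulus, `norm_amplitude_atTop`: `(|a|²)' = -2 Im (g conj V)`, and the integral of `g conj N` is
real because the multiplier is, so `|a(+∞)| = |c|`.

The second is uniqueness, `jost_eq_zero`: if `c = 0`, then `m = 0`. Here `a` vanishes at both ends,
so `a ∈ L²`, and integrating `(x |a|²)'` gives `‖V‖² = 2 Im ⟨V, x g⟩`, with the inner product
conjugate-linear on the left. As `⟨m, x g⟩` is real, this equals `-2 Im ⟨N, x g⟩`, which is at most
`‖N‖²` by `neg_two_mul_im_inner_negRes_le`. But `V = m - N` with `m` in the Hardy space and `N`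
orthogonal to it, so `‖V‖² = ‖m‖² + ‖N‖²`, which forces `m = 0`.

Existence for `c = 1` is the Fredholm alternative for `h = ⟨x⟩ u m` in `L²`: the homogeneous part is
the Hilbert–Schmidt operator `hilbertSchmidt`, and uniqueness excludes the eigenvalue `1`. Thus `m ↦
c` is a linear isomorphism of the eigenspace onto `ℂ`, and conservation of modulus makes the limit
at `+∞` nonzero as well. -/

namespace BenjaminOno

/-! ### The Fourier transform on `L²`, the Hardy space and the Szegő projection. -/

theorem integral_smul_fourier_L2 (a : Lp ℂ 2 (volume : Measure ℝ)) (φ : 𝓢(ℝ, ℂ)) :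
    ∫ x, φ x • (𝓕 a : Lp ℂ 2 (volume : Measure ℝ)) x = ∫ x, (𝓕 φ) x • a x := by
  have h := congrArg (fun T : 𝓢'(ℝ, ℂ) => T φ) (Lp.fourier_toTemperedDistribution_eq a)
  simp only [TemperedDistribution.fourier_apply, Lp.toTemperedDistribution_apply] at h
  exact h.symm

theorem integral_smul_fourierInv_L2 (a : Lp ℂ 2 (volume : Measure ℝ)) (φ : 𝓢(ℝ, ℂ)) :
    ∫ x, φ x • (𝓕⁻ a : Lp ℂ 2 (volume : Measure ℝ)) x = ∫ x, (𝓕⁻ φ) x • a x := by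
  have h := congrArg (fun T : 𝓢'(ℝ, ℂ) => T φ) (Lp.fourierInv_toTemperedDistribution_eq a)
  simp only [TemperedDistribution.fourierInv_apply, Lp.toTemperedDistribution_apply] at h
  exact h.symm

/-- A real-valued smooth compactly supported function, as a complex Schwartz function. -/
noncomputable def bumpSchwartz (g : ℝ → ℝ) (hg : ContDiff ℝ (⊤ : ℕ∞) g)
    (hc : HasCompactSupport g) : 𝓢(ℝ, ℂ) :=
  HasCompactSupport.toSchwartzMap (f := Complex.ofRealCLM ∘ g) (hc.comp_left rfl)
    (Complex.ofRealCLM.contDiff.comp hg)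

@[simp] theorem bumpSchwartz_apply (g : ℝ → ℝ) (hg : ContDiff ℝ (⊤ : ℕ∞) g)
    (hc : HasCompactSupport g) (x : ℝ) : bumpSchwartz g hg hc x = (g x : ℂ) := rfl

theorem tsupport_bumpSchwartz_subset (g : ℝ → ℝ) (hg : ContDiff ℝ (⊤ : ℕ∞) g)
    (hc : HasCompactSupport g) : tsupport (bumpSchwartz g hg hc) ⊆ tsupport g :=
  tsupport_comp_subset (g := Complex.ofRealCLM) rfl g

theorem ae_eq_of_integral_schwartz {f f' : ℝ → ℂ} (hf : LocallyIntegrable f)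
    (hf' : LocallyIntegrable f')
    (h : ∀ φ : 𝓢(ℝ, ℂ), ∫ x, φ x • f x = ∫ x, φ x • f' x) : f =ᵐ[volume] f' := by
  refine ae_eq_of_integral_contDiff_smul_eq hf hf' fun g hg hc => ?_
  simpa using h (bumpSchwartz g hg hc)

theorem locallyIntegrable_Lp_two (a : Lp ℂ 2 (volume : Measure ℝ)) : LocallyIntegrable a :=
  (Lp.memLp a).locallyIntegrable (by norm_num)

theorem ae_eq_zero_of_integral_schwartz_Iio (a : Lp ℂ 2 (volume : Measure ℝ))
    (h : ∀ φ : 𝓢(ℝ, ℂ), tsupport φ ⊆ Set.Iio 0 → ∫ x, φ x • a x = 0) :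
    ∀ᵐ x, x < 0 → a x = 0 := by
  refine IsOpen.ae_eq_zero_of_integral_contDiff_smul_eq_zero (U := Set.Iio (0 : ℝ)) isOpen_Iio
    ((locallyIntegrable_Lp_two a).locallyIntegrableOn _) fun g hg hc hs => ?_
  simpa using h (bumpSchwartz g hg hc) ((tsupport_bumpSchwartz_subset g hg hc).trans hs)

theorem mem_hardy_two_iff (f : Lp ℂ 2 (volume : Measure ℝ)) :
    f ∈ hardy 2 ↔ ∀ᵐ ξ, ξ < 0 → (𝓕 f : Lp ℂ 2 (volume : Measure ℝ)) ξ = 0 := by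
  constructor
  · intro hf
    refine ae_eq_zero_of_integral_schwartz_Iio _ fun φ hφ => ?_
    have := hf φ hφ
    rwa [Lp.fourier_toTemperedDistribution_eq, Lp.toTemperedDistribution_apply] at this
  · intro hf φ hφ
    rw [Lp.fourier_toTemperedDistribution_eq, Lp.toTemperedDistribution_apply]
    refine integral_eq_zero_of_ae ?_
    filter_upwards [hf] with x hx
    by_cases h : x < 0
    · simp [hx h]
    · have : φ x = 0 := by
        by_contra h0
        exact h (hφ (subset_tsupport _ h0))
      simp [this]

/-- Restriction of an `L²` function to a measurable set. -/
noncomputable def cutoff {s : Set ℝ} (hs : MeasurableSet s) (a : Lp ℂ 2 (volume : Measure ℝ)) :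
    Lp ℂ 2 (volume : Measure ℝ) :=
  ((Lp.memLp a).indicator hs).toLp _

theorem coeFn_cutoff {s : Set ℝ} (hs : MeasurableSet s) (a : Lp ℂ 2 (volume : Measure ℝ)) :
    cutoff hs a =ᵐ[volume] s.indicator a :=
  MemLp.coeFn_toLp _

theorem inner_eq_zero_of_ae {a b : Lp ℂ 2 (volume : Measure ℝ)}
    (h : ∀ᵐ x, a x = 0 ∨ b x = 0) : inner ℂ a b = 0 := by
  rw [L2.inner_def]
  refine integral_eq_zero_of_ae ?_
  filter_upwards [h] with x hx
  rcases hx with hx | hx <;> simp [hx]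

theorem fourier_sub_L2 (a b : Lp ℂ 2 (volume : Measure ℝ)) : 𝓕 (a - b) = 𝓕 a - 𝓕 b :=
  (Lp.fourierTransformₗᵢ ℝ ℂ).map_sub a b

/-- The inverse transform of the truncated `𝓕 g` lies in the Hardy space, and its difference from
`g` has only negative frequencies, hence is orthogonal to that space by Plancherel. This
characterises the orthogonal projection. -/
theorem fourier_szego (g : Lp ℂ 2 (volume : Measure ℝ)) :
    𝓕 (szego g) = cutoff measurableSet_Ici (s := Set.Ici (0 : ℝ)) (𝓕 g) := by
  set v : Lp ℂ 2 (volume : Measure ℝ) :=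
    cutoff measurableSet_Ici (s := Set.Ici (0 : ℝ)) (𝓕 g) with hv
  have hc := coeFn_cutoff (measurableSet_Ici (a := (0 : ℝ))) (𝓕 g : Lp ℂ 2 (volume : Measure ℝ))
  have : szego g = 𝓕⁻ v := by
    refine Submodule.eq_starProjection_of_mem_orthogonal ?_ ?_
    · rw [mem_hardy_two_iff, FourierTransform.fourier_fourierInv_eq]
      filter_upwards [hc] with ξ h hξ
      rw [h, Set.indicator_of_notMem (by simpa using hξ)]
    · rw [Submodule.mem_orthogonal]
      intro w hw
      rw [mem_hardy_two_iff] at hw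
      rw [← Lp.inner_fourier_eq, show 𝓕 (g - 𝓕⁻ v) = 𝓕 g - v by
        rw [fourier_sub_L2, FourierTransform.fourier_fourierInv_eq]]
      refine inner_eq_zero_of_ae ?_
      filter_upwards [hc, hw, Lp.coeFn_sub (𝓕 g) v] with ξ h h' h''
      by_cases hξ : ξ < 0
      · exact Or.inl (h' hξ)
      · right
        rw [h'', Pi.sub_apply, hv, h, Set.indicator_of_mem (by simpa using hξ), sub_self]
  rw [this, FourierTransform.fourier_fourierInv_eq]

theorem integral_fourier_smul_of_integrable {f g : ℝ → ℂ} (hf : Integrable f)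
    (hg : Integrable g) : ∫ x, 𝓕 f x • g x = ∫ x, f x • 𝓕 g x := by
  have h := VectorFourier.integral_fourierIntegral_smul_eq_flip (L := innerₗ ℝ)
    Real.continuous_fourierChar continuous_inner hf hg
  rwa [flip_innerₗ] at h

theorem continuous_fourier_of_integrable {f : ℝ → ℂ} (hf : Integrable f) : Continuous (𝓕 f) :=
  VectorFourier.fourierIntegral_continuous Real.continuous_fourierChar (L := innerₗ ℝ)
    continuous_inner hf

theorem integral_fourierInv_smul_of_integrable {f g : ℝ → ℂ} (hf : Integrable f)
    (hg : Integrable g) : ∫ x, 𝓕⁻ f x • g x = ∫ x, f x • 𝓕⁻ g x := by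
  simp only [Real.fourierInv_eq_fourier_comp_neg]
  rw [integral_fourier_smul_of_integrable hf.comp_neg hg,
    ← integral_fourier_smul_of_integrable hf hg.comp_neg,
    integral_fourier_smul_of_integrable hf hg.comp_neg]
  rw [← integral_neg_eq_self]
  simp [Real.fourierInv_eq_fourier_comp_neg, ← Real.fourierInv_eq_fourier_neg]

/-- Both transforms are moved onto a Schwartz function in the pairing, where they agree. -/
theorem fourier_toLp_ae_eq {f : ℝ → ℂ} (h1 : Integrable f) (h2 : MemLp f 2) :
    (𝓕 (h2.toLp f) : Lp ℂ 2 (volume : Measure ℝ)) =ᵐ[volume] 𝓕 f := by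
  refine ae_eq_of_integral_schwartz (locallyIntegrable_Lp_two _)
    (continuous_fourier_of_integrable h1).locallyIntegrable fun φ => ?_
  rw [integral_smul_fourier_L2, ← integral_fourier_smul_of_integrable φ.integrable h1,
    SchwartzMap.fourier_coe]
  refine integral_congr_ae ?_
  filter_upwards [h2.coeFn_toLp] with x hx
  rw [hx]

theorem fourierInv_toLp_ae_eq {f : ℝ → ℂ} (h1 : Integrable f) (h2 : MemLp f 2) :
    (𝓕⁻ (h2.toLp f) : Lp ℂ 2 (volume : Measure ℝ)) =ᵐ[volume] 𝓕⁻ f := by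
  have hc : Continuous (𝓕⁻ f) := by
    rw [Real.fourierInv_eq_fourier_comp_neg]
    exact continuous_fourier_of_integrable h1.comp_neg
  refine ae_eq_of_integral_schwartz (locallyIntegrable_Lp_two _) hc.locallyIntegrable fun φ => ?_
  rw [integral_smul_fourierInv_L2, ← integral_fourierInv_smul_of_integrable φ.integrable h1,
    SchwartzMap.fourierInv_coe]
  refine integral_congr_ae ?_
  filter_upwards [h2.coeFn_toLp] with x hx
  rw [hx]

/-! ### Calculus of primitives of locally integrable functions. -/

theorem intervalIntegrable_of_locallyIntegrable {E : Type*} [NormedAddCommGroup E] {f : ℝ → E}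
    (hf : LocallyIntegrable f) (a b : ℝ) : IntervalIntegrable f volume a b :=
  (hf.integrableOn_isCompact isCompact_uIcc).intervalIntegrable

/-- Primitives are absolutely continuous with the expected derivative almost everywhere, so
integration by parts for absolutely continuous functions applies. Pointwise differentiability is not
available, since `g = u m` is only an `L²` class. -/
theorem integral_mul_add_mul_of_primitive {P Q f g : ℝ → ℝ} (hf : LocallyIntegrable f)
    (hg : LocallyIntegrable g) (hP : ∀ a b, ∫ x in a..b, f x = P b - P a)
    (hQ : ∀ a b, ∫ x in a..b, g x = Q b - Q a) (a b : ℝ) :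
    ∫ x in a..b, (f x * Q x + P x * g x) = P b * Q b - P a * Q a := by
  have key : ∀ {R h : ℝ → ℝ}, LocallyIntegrable h → (∀ a b, ∫ x in a..b, h x = R b - R a) →
      AbsolutelyContinuousOnInterval R a b ∧
        ∀ᵐ x, x ∈ Set.uIcc a b → deriv R x = h x := by
    intro R h hh hR
    have hi : IntervalIntegrable h volume a b := intervalIntegrable_of_locallyIntegrable hh a b
    have hRe : R = fun x => R a + ∫ t in a..x, h t := by
      ext x; rw [hR]; ring
    constructor
    · have h1 := hi.absolutelyContinuousOnInterval_intervalIntegral (c := a) Set.left_mem_uIcc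
      have h2 : AbsolutelyContinuousOnInterval (fun _ : ℝ => R a) a b :=
        (LipschitzWith.const (R a)).lipschitzOnWith.absolutelyContinuousOnInterval
      rw [hRe]
      exact h2.add h1
    · filter_upwards [hi.ae_hasDerivAt_integral] with x hx hxm
      rw [hRe]
      exact ((hx hxm a Set.left_mem_uIcc).const_add (R a)).deriv
  obtain ⟨h1, h2⟩ := key hf hP
  obtain ⟨h3, h4⟩ := key hg hQ
  rw [← h1.integral_deriv_mul_eq_sub h3]
  refine intervalIntegral.integral_congr_ae ?_
  filter_upwards [h2, h4] with x hx hx' hxm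
  rw [hx (Set.uIoc_subset_uIcc hxm), hx' (Set.uIoc_subset_uIcc hxm)]

/-- `P` is a primitive of the locally integrable function `f`. -/
structure IsPrimitive (P f : ℝ → ℂ) : Prop where
  locallyIntegrable : LocallyIntegrable f
  integral_eq : ∀ a b, ∫ x in a..b, f x = P b - P a

namespace IsPrimitive

variable {P Q f g : ℝ → ℂ}

theorem continuous (h : IsPrimitive P f) : Continuous P := by
  have : P = fun x => P 0 + ∫ t in (0 : ℝ)..x, f t := by
    ext x; rw [h.integral_eq]; ring
  rw [this]
  exact continuous_const.add
    (intervalIntegral.continuous_primitive (intervalIntegrable_of_locallyIntegrable h.locallyIntegrable) 0)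

theorem of_hasDerivAt (hd : ∀ x, HasDerivAt P (f x) x) (hf : Continuous f) : IsPrimitive P f :=
  ⟨hf.locallyIntegrable, fun a b => intervalIntegral.integral_eq_sub_of_hasDerivAt
    (fun x _ => hd x) (hf.intervalIntegrable a b)⟩

theorem const_add (h : IsPrimitive P f) (c : ℂ) : IsPrimitive (fun x => c + P x) f :=
  ⟨h.locallyIntegrable, fun a b => by rw [h.integral_eq]; ring⟩

theorem clm_comp (L : ℂ →L[ℝ] ℂ) (h : IsPrimitive P f) :
    IsPrimitive (fun x => L (P x)) (fun x => L (f x)) := by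
  have hl : LocallyIntegrable (fun x => L (f x)) := by
    intro x
    obtain ⟨s, hs, hi⟩ := h.locallyIntegrable x
    exact ⟨s, hs, L.integrable_comp hi⟩
  refine ⟨hl, fun a b => ?_⟩
  rw [L.intervalIntegral_comp_comm
    (intervalIntegrable_of_locallyIntegrable h.locallyIntegrable a b), h.integral_eq, map_sub]

theorem conj (h : IsPrimitive P f) :
    IsPrimitive (fun x => star (P x)) (fun x => star (f x)) :=
  h.clm_comp (Complex.conjCLE : ℂ →L[ℝ] ℂ)

theorem re_primitive (h : IsPrimitive P f) : LocallyIntegrable (fun x => (f x).re) ∧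
    ∀ a b, ∫ x in a..b, (f x).re = (P b).re - (P a).re := by
  refine ⟨fun x => ?_, fun a b => ?_⟩
  · obtain ⟨s, hs, hi⟩ := h.locallyIntegrable x
    exact ⟨s, hs, Complex.reCLM.integrable_comp hi⟩
  · have := Complex.reCLM.intervalIntegral_comp_comm
      (intervalIntegrable_of_locallyIntegrable h.locallyIntegrable a b)
    rw [h.integral_eq] at this
    simpa using this

theorem im_primitive (h : IsPrimitive P f) : LocallyIntegrable (fun x => (f x).im) ∧
    ∀ a b, ∫ x in a..b, (f x).im = (P b).im - (P a).im := by
  refine ⟨fun x => ?_, fun a b => ?_⟩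
  · obtain ⟨s, hs, hi⟩ := h.locallyIntegrable x
    exact ⟨s, hs, Complex.imCLM.integrable_comp hi⟩
  · have := Complex.imCLM.intervalIntegral_comp_comm
      (intervalIntegrable_of_locallyIntegrable h.locallyIntegrable a b)
    rw [h.integral_eq] at this
    simpa using this

theorem locallyIntegrable_mul_add_mul (hP : IsPrimitive P f) (hQ : IsPrimitive Q g) :
    LocallyIntegrable (fun x => f x * Q x + P x * g x) := by
  exact (LocallyIntegrable.mul_continuous hQ.continuous hP.locallyIntegrable).add
    (LocallyIntegrable.continuous_mul hP.continuous hQ.locallyIntegrable)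

/-- The product rule above is for real functions; the complex one follows from its four combinations
of real and imaginary parts. -/
theorem mul (hP : IsPrimitive P f) (hQ : IsPrimitive Q g) :
    IsPrimitive (fun x => P x * Q x) (fun x => f x * Q x + P x * g x) := by
  have hl := locallyIntegrable_mul_add_mul hP hQ
  refine ⟨hl, fun a b => ?_⟩
  obtain ⟨pr, pr'⟩ := hP.re_primitive
  obtain ⟨pi, pi'⟩ := hP.im_primitive
  obtain ⟨qr, qr'⟩ := hQ.re_primitive
  obtain ⟨qi, qi'⟩ := hQ.im_primitive
  have e1 := integral_mul_add_mul_of_primitive pr qr pr' qr' a b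
  have e2 := integral_mul_add_mul_of_primitive pi qi pi' qi' a b
  have e3 := integral_mul_add_mul_of_primitive pr qi pr' qi' a b
  have e4 := integral_mul_add_mul_of_primitive pi qr pi' qr' a b
  have cP := hP.continuous
  have cQ := hQ.continuous
  have ii : ∀ {u v p q : ℝ → ℝ}, LocallyIntegrable u → LocallyIntegrable v → Continuous p →
      Continuous q → IntervalIntegrable (fun x => u x * q x + p x * v x) volume a b :=
    fun hu hv hp hq => ((intervalIntegrable_of_locallyIntegrable hu a b).mul_continuousOn hq.continuousOn).add
      ((intervalIntegrable_of_locallyIntegrable hv a b).continuousOn_mul hp.continuousOn)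
  have cpr : Continuous fun x => (P x).re := Complex.continuous_re.comp cP
  have cpi : Continuous fun x => (P x).im := Complex.continuous_im.comp cP
  have cqr : Continuous fun x => (Q x).re := Complex.continuous_re.comp cQ
  have cqi : Continuous fun x => (Q x).im := Complex.continuous_im.comp cQ
  have hre := Complex.reCLM.intervalIntegral_comp_comm (intervalIntegrable_of_locallyIntegrable hl a b)
  have him := Complex.imCLM.intervalIntegral_comp_comm (intervalIntegrable_of_locallyIntegrable hl a b)
  simp only [Complex.reCLM_apply, Complex.imCLM_apply] at hre him
  apply Complex.ext
  · rw [← hre]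
    have := intervalIntegral.integral_sub (ii pr qr cpr cqr) (ii pi qi cpi cqi)
    rw [e1, e2] at this
    simp only [Complex.sub_re, Complex.mul_re]
    rw [show ∀ x y z w : ℝ, x - y - (z - w) = x - z - (y - w) by intros; ring, ← this]
    congr 1; ext x; simp; ring
  · rw [← him]
    have := intervalIntegral.integral_add (ii pr qi cpr cqi) (ii pi qr cpi cqr)
    rw [e3, e4] at this
    simp only [Complex.sub_im, Complex.mul_im]
    rw [show ∀ x y z w : ℝ, x + y - (z + w) = x - z + (y - w) by intros; ring, ← this]
    congr 1; ext x; simp; ring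

end IsPrimitive

/-- The primitive of an integrable function vanishing at `-∞`. -/
theorem isPrimitive_integral_Iic {f : ℝ → ℂ} (hf : Integrable f) :
    IsPrimitive (fun x => ∫ y in Set.Iic x, f y) f :=
  ⟨hf.locallyIntegrable, fun _ _ =>
    (intervalIntegral.integral_Iic_sub_Iic hf.integrableOn hf.integrableOn).symm⟩

theorem tendsto_integral_Iic_atBot {f : ℝ → ℂ} (hf : Integrable f) :
    Tendsto (fun x => ∫ y in Set.Iic x, f y) atBot (𝓝 0) := by
  have h := (intervalIntegral_tendsto_integral_Iic (0 : ℝ) hf.integrableOn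
    (tendsto_id (α := ℝ) (x := atBot))).const_sub (∫ y in Set.Iic 0, f y)
  rw [sub_self] at h
  refine h.congr fun x => ?_
  rw [id, ← intervalIntegral.integral_Iic_sub_Iic hf.integrableOn hf.integrableOn]
  ring

theorem tendsto_integral_Iic_atTop {f : ℝ → ℂ} (hf : Integrable f) :
    Tendsto (fun x => ∫ y in Set.Iic x, f y) atTop (𝓝 (∫ y, f y)) := by
  have h := tendsto_setIntegral_of_monotone (μ := volume) (f := f) (s := fun x : ℝ => Set.Iic x)
    (fun _ => measurableSet_Iic) (fun _ _ h => Set.Iic_subset_Iic.2 h)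
    hf.integrableOn
  rwa [Set.iUnion_Iic, setIntegral_univ] at h

theorem norm_integral_Iic_le {f : ℝ → ℂ} (hf : Integrable f) (x : ℝ) :
    ‖∫ y in Set.Iic x, f y‖ ≤ ∫ y, ‖f y‖ :=
  (norm_integral_le_integral_norm _).trans
    (setIntegral_le_integral hf.norm (Eventually.of_forall fun _ => norm_nonneg _))

theorem IsPrimitive.integral_eq_of_tendsto {P f : ℝ → ℂ} (h : IsPrimitive P f)
    (hf : Integrable f) {a b : ℂ} (ha : Tendsto P atBot (𝓝 a)) (hb : Tendsto P atTop (𝓝 b)) :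
    ∫ x, f x = b - a := by
  have h1 := intervalIntegral_tendsto_integral (l := atTop) hf tendsto_neg_atTop_atBot
    (tendsto_id (α := ℝ))
  simp only [h.integral_eq] at h1
  exact tendsto_nhds_unique h1 ((hb.comp tendsto_id).sub (ha.comp tendsto_neg_atTop_atBot))

/-! ### Division of test functions on the negative half-line by `2πξ - lam`. -/

theorem eventuallyEq_zero_of_tsupport_subset {φ : ℝ → ℂ} {s : Set ℝ} (hφ : tsupport φ ⊆ s) {x : ℝ}
    (hx : x ∉ s) : φ =ᶠ[𝓝 x] 0 :=
  notMem_tsupport_iff_eventuallyEq.1 fun h => hx (hφ h)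

/-- The function `ξ ↦ φ ξ / (2πξ - lam) ^ j`. -/
noncomputable def divPow (lam : ℝ) (j : ℕ) (φ : ℝ → ℂ) (ξ : ℝ) : ℂ :=
  φ ξ * (((2 * Real.pi * ξ - lam : ℝ) : ℂ)⁻¹) ^ j

theorem sub_ne_zero_of_neg {lam : ℝ} (hlam : 0 < lam) {x : ℝ} (hx : x < 0) :
    (((2 * Real.pi * x - lam : ℝ)) : ℂ) ≠ 0 := by
  have : 2 * Real.pi * x < 0 := mul_neg_of_pos_of_neg Real.two_pi_pos hx
  exact_mod_cast (by linarith : (2 * Real.pi * x - lam : ℝ) < 0).ne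

theorem contDiff_divPow {lam : ℝ} (hlam : 0 < lam) (j : ℕ) {φ : ℝ → ℂ} {n : ℕ∞}
    (hs : ContDiff ℝ n φ) (hφ : tsupport φ ⊆ Set.Iio 0) : ContDiff ℝ n (divPow lam j φ) := by
  rw [contDiff_iff_contDiffAt]
  intro x
  by_cases hx : x < 0
  · have h1 : ContDiffAt ℝ n (fun ξ : ℝ => ((2 * Real.pi * ξ - lam : ℝ) : ℂ)) x :=
      (Complex.ofRealCLM.contDiff.comp
        ((contDiff_const.mul contDiff_id).sub contDiff_const)).contDiffAt
    exact hs.contDiffAt.mul ((h1.inv (sub_ne_zero_of_neg hlam hx)).pow j)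
  · have h := eventuallyEq_zero_of_tsupport_subset hφ (x := x) hx
    refine (contDiffAt_const (c := (0 : ℂ))).congr_of_eventuallyEq ?_
    filter_upwards [h] with y hy
    simp [divPow, hy]

/-- The numerator of the derivative of `φ / (2πξ - lam) ^ j`. -/
noncomputable def divPowDeriv (lam : ℝ) (j : ℕ) (φ : 𝓢(ℝ, ℂ)) : 𝓢(ℝ, ℂ) :=
  SchwartzMap.smulLeftCLM ℂ (fun ξ : ℝ => ((2 * Real.pi * ξ - lam : ℝ) : ℂ))
    (SchwartzMap.derivCLM ℂ ℂ φ) - (2 * Real.pi * j : ℂ) • φ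

theorem hasTemperateGrowth_linear (lam : ℝ) :
    (fun ξ : ℝ => ((2 * Real.pi * ξ - lam : ℝ) : ℂ)).HasTemperateGrowth := by
  have : (fun ξ : ℝ => (2 * Real.pi * ξ - lam : ℝ)).HasTemperateGrowth := by fun_prop
  exact Complex.ofRealCLM.hasTemperateGrowth.comp this

theorem divPowDeriv_apply (lam : ℝ) (j : ℕ) (φ : 𝓢(ℝ, ℂ)) (x : ℝ) :
    divPowDeriv lam j φ x =
      ((2 * Real.pi * x - lam : ℝ) : ℂ) * deriv φ x - 2 * Real.pi * j * φ x := by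
  rw [divPowDeriv, sub_apply, smul_apply,
    SchwartzMap.smulLeftCLM_apply_apply (hasTemperateGrowth_linear lam), SchwartzMap.derivCLM_apply]
  simp

theorem tsupport_divPowDeriv_subset (lam : ℝ) (j : ℕ) {φ : 𝓢(ℝ, ℂ)} {s : Set ℝ}
    (hφ : tsupport φ ⊆ s) : tsupport (divPowDeriv lam j φ) ⊆ s := by
  refine (closure_minimal (fun x hx => ?_) (isClosed_tsupport φ)).trans hφ
  by_contra h
  have h0 := notMem_tsupport_iff_eventuallyEq.1 h
  apply hx
  rw [divPowDeriv_apply, h0.deriv_eq, h0.eq_of_nhds]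
  simp

/-- Differentiation stays within the family of quotients of Schwartz functions by powers of `2πξ -
lam`, which is what makes the induction for the decay estimates work. -/
theorem deriv_divPow {lam : ℝ} (hlam : 0 < lam) (j : ℕ) (φ : 𝓢(ℝ, ℂ))
    (hφ : tsupport φ ⊆ Set.Iio 0) :
    deriv (divPow lam j φ) = divPow lam (j + 1) (divPowDeriv lam j φ) := by
  ext x
  by_cases hx : x < 0
  · have h0 := sub_ne_zero_of_neg hlam hx
    have h1 : HasDerivAt (fun ξ : ℝ => ((2 * Real.pi * ξ - lam : ℝ) : ℂ)) ((2 * Real.pi : ℝ) : ℂ) x := by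
      have := (((hasDerivAt_id x).const_mul (2 * Real.pi)).sub_const lam).ofReal_comp
      simpa using this
    have h2 := (φ.differentiableAt (x := x)).hasDerivAt.mul ((h1.inv h0).pow j)
    refine h2.deriv.trans ?_
    rw [divPow, divPowDeriv_apply]
    simp only [Pi.pow_apply, Pi.inv_apply]
    generalize ((2 * Real.pi * x - lam : ℝ) : ℂ) = c at h0
    rcases j with _ | j
    · simp only [pow_zero, zero_add, pow_one, Nat.cast_zero, zero_mul, mul_zero, add_zero,
        sub_zero, mul_one]
      field_simp
    · simp only [Nat.add_sub_cancel, inv_pow]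
      field_simp
      push_cast
      ring
  · have h := eventuallyEq_zero_of_tsupport_subset hφ (x := x) hx
    have h' : divPow lam j φ =ᶠ[𝓝 x] 0 := by
      filter_upwards [h] with y hy
      simp [divPow, hy]
    rw [h'.deriv_eq, divPow, divPowDeriv_apply, h.deriv_eq, h.eq_of_nhds]
    simp

/-- Each derivative changes both the numerator and the exponent, so the induction on `n` keeps `j`
and `φ` universally quantified. The base case uses `|2πξ - lam| ≥ lam` for `ξ < 0`. -/
theorem decay_divPow {lam : ℝ} (hlam : 0 < lam) (k n : ℕ) : ∀ (j : ℕ) (φ : 𝓢(ℝ, ℂ)),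
    tsupport φ ⊆ Set.Iio 0 →
      ∃ C : ℝ, ∀ x, ‖x‖ ^ k * ‖iteratedDeriv n (divPow lam j φ) x‖ ≤ C := by
  induction n with
  | zero =>
    intro j φ hφ
    obtain ⟨C, hC⟩ := φ.decay k 0
    refine ⟨C * (lam⁻¹) ^ j, fun x => ?_⟩
    have hx' := hC.2 x
    rw [norm_iteratedFDeriv_zero] at hx'
    have hC0 : 0 ≤ C := hC.1.le
    rw [iteratedDeriv_zero]
    by_cases hx : x < 0
    · have hpi : 2 * Real.pi * x < 0 := mul_neg_of_pos_of_neg Real.two_pi_pos hx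
      rw [divPow, norm_mul, norm_pow, norm_inv, Complex.norm_real,
        Real.norm_of_nonpos (r := _ - lam) (by linarith), ← mul_assoc]
      have h0 : 0 ≤ (-(2 * Real.pi * x - lam))⁻¹ := inv_nonneg.2 (by linarith)
      refine mul_le_mul hx' (pow_le_pow_left₀ h0 ?_ j) (pow_nonneg h0 j) hC0
      exact inv_anti₀ hlam (by linarith)
    · have h := (eventuallyEq_zero_of_tsupport_subset hφ (x := x) hx).eq_of_nhds
      rw [divPow, h]
      simp only [Pi.zero_apply, zero_mul, norm_zero, mul_zero]
      positivity
  | succ n ih =>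
    intro j φ hφ
    simp only [iteratedDeriv_succ', deriv_divPow hlam j φ hφ]
    exact ih (j + 1) _ (tsupport_divPowDeriv_subset lam j hφ)

/-- The zero `lam / 2π` of the divisor is positive, hence away from the support of `φ`. This is how
the Hardy condition for solutions will be checked. -/
theorem exists_schwartz_div {lam : ℝ} (hlam : 0 < lam) (φ : 𝓢(ℝ, ℂ))
    (hφ : tsupport φ ⊆ Set.Iio 0) : ∃ ψ : 𝓢(ℝ, ℂ), tsupport ψ ⊆ Set.Iio 0 ∧
      SchwartzMap.smulLeftCLM ℂ (fun ξ : ℝ => ((2 * Real.pi * ξ - lam : ℝ) : ℂ)) ψ = φ := by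
  refine ⟨⟨divPow lam 1 φ, contDiff_divPow hlam 1 φ.smooth' hφ, fun k n => ?_⟩, ?_, ?_⟩
  · simpa only [norm_iteratedFDeriv_eq_norm_iteratedDeriv] using decay_divPow hlam k n 1 φ hφ
  · refine (closure_minimal (fun x hx => ?_) (isClosed_tsupport φ)).trans hφ
    refine subset_tsupport _ fun h => hx ?_
    change divPow lam 1 φ x = 0
    rw [divPow, h, zero_mul]
  · ext x
    rw [SchwartzMap.smulLeftCLM_apply_apply (hasTemperateGrowth_linear lam), smul_eq_mul]
    change _ * divPow lam 1 φ x = _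
    by_cases hx : x < 0
    · have h0 := sub_ne_zero_of_neg hlam hx
      rw [divPow, pow_one, mul_comm (φ x), mul_inv_cancel_left₀ h0]
    · have h := (eventuallyEq_zero_of_tsupport_subset hφ (x := x) hx).eq_of_nhds
      rw [divPow, h]
      simp

/-! ### Weak solutions of the homogeneous equation. -/

/-- A test function with vanishing integral is the derivative of a test function. -/
theorem exists_primitive_testFunction {θ : ℝ → ℝ} (hs : ContDiff ℝ (⊤ : ℕ∞) θ)
    (hc : HasCompactSupport θ) (h0 : ∫ x, θ x = 0) :
    ∃ Θ : ℝ → ℝ, ContDiff ℝ (⊤ : ℕ∞) Θ ∧ HasCompactSupport Θ ∧ deriv Θ = θ := by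
  obtain ⟨R, hR⟩ := hc.isCompact.isBounded.subset_ball 0
  rw [Real.ball_eq_Ioo, zero_sub, zero_add] at hR
  have hz : ∀ x, x ∉ Set.Ioo (-R) R → θ x = 0 := fun x hx => by
    by_contra h
    exact hx (hR (subset_tsupport _ h))
  have hi : Integrable θ := hs.continuous.integrable_of_hasCompactSupport hc
  have hd : ∀ x : ℝ, HasDerivAt (fun x => ∫ t in (-R)..x, θ t) (θ x) x := fun x =>
    intervalIntegral.integral_hasDerivAt_right (hs.continuous.intervalIntegrable _ _)
      (hs.continuous.stronglyMeasurableAtFilter _ _) hs.continuous.continuousAt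
  have hd' : deriv (fun x => ∫ t in (-R)..x, θ t) = θ := funext fun x => (hd x).deriv
  refine ⟨fun x => ∫ t in (-R)..x, θ t, ?_, ?_, hd'⟩
  · rw [contDiff_infty_iff_deriv, hd']
    exact ⟨fun x => (hd x).differentiableAt, hs⟩
  · refine HasCompactSupport.of_support_subset_isCompact (isCompact_Icc (a := -R) (b := R)) ?_
    intro x hx
    by_contra hxm
    apply hx
    rw [Set.mem_Icc, not_and_or, not_le, not_le] at hxm
    rcases hxm with hx1 | hx1
    · refine intervalIntegral.integral_zero_ae (Eventually.of_forall fun t ht => hz t ?_)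
      rw [Set.uIoc_of_ge hx1.le] at ht
      exact fun h => not_lt.2 ht.2 h.1
    · have h1 : ∫ t in Set.Iic x, θ t = 0 := by
        rw [setIntegral_eq_integral_of_forall_compl_eq_zero, h0]
        intro t ht
        exact hz t fun h => ht (h.2.trans hx1).le
      have h2 : ∫ t in Set.Iic (-R), θ t = 0 := by
        refine setIntegral_eq_zero_of_forall_eq_zero fun t ht => hz t fun h => ?_
        exact not_lt.2 ht h.1
      beta_reduce
      rw [← intervalIntegral.integral_Iic_sub_Iic hi.integrableOn hi.integrableOn, h1, h2, sub_zero]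

/-- A locally integrable function whose weak derivative vanishes is almost everywhere constant. -/
theorem ae_eq_const_of_integral_deriv_smul {N : ℝ → ℂ} (hN : LocallyIntegrable N)
    (h : ∀ ψ : ℝ → ℝ, ContDiff ℝ (⊤ : ℕ∞) ψ → HasCompactSupport ψ → ∫ x, deriv ψ x • N x = 0) :
    ∃ c : ℂ, N =ᵐ[volume] fun _ => c := by
  let b : ContDiffBump (0 : ℝ) := ⟨1, 2, one_pos, one_lt_two⟩
  set ψ₀ : ℝ → ℝ := b.normed volume with hψ₀
  have s₀ : ContDiff ℝ (⊤ : ℕ∞) ψ₀ := b.contDiff_normed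
  have c₀ : HasCompactSupport ψ₀ := b.hasCompactSupport_normed
  have i₀ : ∫ x, ψ₀ x = 1 := b.integral_normed
  refine ⟨∫ x, ψ₀ x • N x, ae_eq_of_integral_contDiff_smul_eq hN
    (locallyIntegrable_const _) fun g hg hc => ?_⟩
  have ig : Integrable g := hg.continuous.integrable_of_hasCompactSupport hc
  have i0 : Integrable ψ₀ := s₀.continuous.integrable_of_hasCompactSupport c₀
  -- Subtracting `(∫ g) ψ₀`, with `∫ ψ₀ = 1`, leaves a test function of mean zero, that is, a
  -- derivative.
  obtain ⟨Θ, h1, h2, h3⟩ := exists_primitive_testFunction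
    (θ := fun x => g x - (∫ y, g y) * ψ₀ x) (hg.sub (contDiff_const.mul s₀))
    (hc.sub c₀.mul_left)
    (by rw [integral_sub ig (i0.const_mul _), integral_const_mul, i₀, mul_one, sub_self])
  have h4 := h Θ h1 h2
  rw [h3] at h4
  have j1 : Integrable (fun x => g x • N x) :=
    hN.integrable_smul_left_of_hasCompactSupport hg.continuous hc
  have j2 : Integrable (fun x => ψ₀ x • N x) :=
    hN.integrable_smul_left_of_hasCompactSupport s₀.continuous c₀
  simp only [sub_smul, mul_smul] at h4
  rw [integral_sub j1 (j2.fun_smul _), integral_smul, sub_eq_zero] at h4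
  rw [h4, integral_smul_const]

/-- A locally integrable weak solution of `i φ' + lam φ = 0` is a multiple of `exp (i lam x)`. -/
theorem ae_eq_exp_of_weak_solution (lam : ℝ) {n : ℝ → ℂ} (hn : LocallyIntegrable n)
    (h : ∀ φ : 𝓢(ℝ, ℂ), ∫ x, (Complex.I * deriv φ x - lam * φ x) * n x = 0) :
    ∃ c : ℂ, n =ᵐ[volume] fun x => c * Complex.exp (Complex.I * lam * x) := by
  have hexp : ContDiff ℝ (⊤ : ℕ∞) (fun x : ℝ => Complex.exp (-(Complex.I * lam * x))) :=
    (contDiff_const.mul Complex.ofRealCLM.contDiff).neg.cexp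
  -- Conjugation by the exponential: testing against `exp (-i lam x) ψ` cancels the zeroth-order
  -- term and leaves `i ψ' exp (-i lam x) n`.
  obtain ⟨c, hc⟩ := ae_eq_const_of_integral_deriv_smul
    (N := fun x => Complex.exp (-(Complex.I * lam * x)) * n x)
    (LocallyIntegrable.continuous_mul hexp.continuous hn) (by
      intro ψ hψ hc
      have hsm : ContDiff ℝ (⊤ : ℕ∞) (fun x : ℝ => Complex.exp (-(Complex.I * lam * x)) * (ψ x : ℂ)) :=
        hexp.mul (Complex.ofRealCLM.contDiff.comp hψ)
      have hcs : HasCompactSupport (fun x : ℝ => Complex.exp (-(Complex.I * lam * x)) * (ψ x : ℂ)) :=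
        (hc.comp_left (g := fun t : ℝ => (t : ℂ)) rfl).mul_left
      have h1 := h (hcs.toSchwartzMap hsm)
      have hd : ∀ x : ℝ, HasDerivAt (hcs.toSchwartzMap hsm)
          (Complex.exp (-(Complex.I * lam * x)) * -(Complex.I * lam) * ψ x +
            Complex.exp (-(Complex.I * lam * x)) * ((deriv ψ x : ℝ) : ℂ)) x := by
        intro x
        have e1 : HasDerivAt (fun x : ℝ => -(Complex.I * lam * x)) (-(Complex.I * lam)) x := by
          simpa using ((hasDerivAt_id x).ofReal_comp.const_mul (Complex.I * lam)).fun_neg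
        exact e1.cexp.mul ((hψ.differentiable (by simp) x).hasDerivAt.ofReal_comp)
      have h2 : Complex.I * ∫ x : ℝ, deriv ψ x • (Complex.exp (-(Complex.I * lam * x)) * n x) = 0 := by
        rw [← integral_const_mul, ← h1]
        refine integral_congr_ae (Eventually.of_forall fun x => ?_)
        simp only [(hd x).deriv]
        change _ = (_ - lam * (Complex.exp (-(Complex.I * lam * (x : ℝ))) * (ψ x : ℂ))) * n x
        rw [Complex.real_smul]
        linear_combination (lam * Complex.exp (-(Complex.I * lam * x)) * ψ x * n x) * Complex.I_sq
      simpa using h2)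
  refine ⟨c, ?_⟩
  filter_upwards [hc] with x hx
  rw [← hx, mul_right_comm, ← Complex.exp_add]
  simp

/-! ### The resolvent on negative frequencies. -/

/-- The symbol `1_{ξ < 0} / (lam - 2πξ)` of the resolvent `(lam + i ∂ₓ)⁻¹` on negative
frequencies. -/
noncomputable def negSymbol (lam ξ : ℝ) : ℝ := if ξ < 0 then (lam - 2 * Real.pi * ξ)⁻¹ else 0

theorem measurable_negSymbol (lam : ℝ) : Measurable (negSymbol lam) :=
  Measurable.ite measurableSet_Iio (by fun_prop) measurable_const

theorem negSymbol_nonneg {lam : ℝ} (hlam : 0 < lam) (ξ : ℝ) : 0 ≤ negSymbol lam ξ := by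
  unfold negSymbol
  split_ifs with h
  · have : 2 * Real.pi * ξ < 0 := mul_neg_of_pos_of_neg Real.two_pi_pos h
    exact inv_nonneg.2 (by linarith)
  · exact le_rfl

theorem negSymbol_le {lam : ℝ} (hlam : 0 < lam) (ξ : ℝ) : negSymbol lam ξ ≤ lam⁻¹ := by
  unfold negSymbol
  split_ifs with h
  · have : 2 * Real.pi * ξ < 0 := mul_neg_of_pos_of_neg Real.two_pi_pos h
    exact inv_anti₀ hlam (by linarith)
  · exact (inv_pos.2 hlam).le

theorem sub_mul_negSymbol {lam : ℝ} (hlam : 0 < lam) {ξ : ℝ} (hξ : ξ < 0) :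
    (2 * Real.pi * ξ - lam) * negSymbol lam ξ = -1 := by
  have : 2 * Real.pi * ξ < 0 := mul_neg_of_pos_of_neg Real.two_pi_pos hξ
  rw [negSymbol, if_pos hξ, ← neg_sub, neg_mul, mul_inv_cancel₀ (by linarith)]

/-- For `ξ < 0` one has `lam - 2πξ ≥ lam - ξ`, and `(lam - ξ)² (lam⁻² + 1) ≥ 1 + ξ²`; this is the
origin of the constant in the majorant. -/
theorem integrable_negSymbol_sq {lam : ℝ} (hlam : 0 < lam) :
    Integrable (fun ξ => negSymbol lam ξ ^ 2) := by
  refine Integrable.mono' (integrable_inv_one_add_sq.const_mul (lam⁻¹ ^ 2 + 1))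
    ((measurable_negSymbol lam).pow_const 2).aestronglyMeasurable (Eventually.of_forall fun ξ => ?_)
  rw [Real.norm_of_nonneg (sq_nonneg _)]
  unfold negSymbol
  split_ifs with h
  · have h1 : 2 * Real.pi * ξ ≤ ξ := by nlinarith [Real.pi_gt_three]
    have h2 : 0 < lam - ξ := by linarith
    rw [inv_pow, ← div_eq_mul_inv, inv_pow, le_div_iff₀ (by positivity),
      inv_mul_le_iff₀ (by nlinarith)]
    have h3 : (lam - ξ) ^ 2 ≤ (lam - 2 * Real.pi * ξ) ^ 2 := by
      apply pow_le_pow_left₀ h2.le; linarith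
    have h4 : 0 < lam ^ 2 := by positivity
    have h5 : 1 + ξ ^ 2 ≤ (lam - ξ) ^ 2 * ((lam ^ 2)⁻¹ + 1) := by
      have e : (lam - ξ) ^ 2 * ((lam ^ 2)⁻¹ + 1) = 1 + ξ ^ 2 + (lam ^ 2 + 2 * lam * (-ξ)
          + (ξ ^ 2 + 2 * lam * (-ξ)) * (lam ^ 2)⁻¹) := by field_simp; ring
      have h6 : 0 < -ξ := by linarith
      rw [e]
      have : 0 ≤ lam ^ 2 + 2 * lam * (-ξ) + (ξ ^ 2 + 2 * lam * (-ξ)) * (lam ^ 2)⁻¹ := by positivity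
      linarith
    exact h5.trans (mul_le_mul_of_nonneg_right h3 (by positivity))
  · have : 0 < 1 + ξ ^ 2 := by positivity
    simp only [ne_eq, OfNat.ofNat_ne_zero, not_false_eq_true, zero_pow]
    positivity

theorem memLp_top_negSymbol {lam : ℝ} (hlam : 0 < lam) :
    MemLp (fun ξ => (negSymbol lam ξ : ℂ)) ∞ :=
  memLp_top_of_bound (Complex.measurable_ofReal.comp
    (measurable_negSymbol lam)).aestronglyMeasurable lam⁻¹ (Eventually.of_forall fun ξ => by
      rw [Complex.norm_real, Real.norm_of_nonneg (negSymbol_nonneg hlam ξ)]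
      exact negSymbol_le hlam ξ)

/-- The operator `(lam + i ∂ₓ)⁻¹ (1 - Π)` on `L²`. -/
noncomputable def negRes {lam : ℝ} (hlam : 0 < lam) :
    Lp ℂ 2 (volume : Measure ℝ) →L[ℂ] Lp ℂ 2 (volume : Measure ℝ) :=
  (Lp.fourierTransformₗᵢ ℝ ℂ).symm.toContinuousLinearEquiv.toContinuousLinearMap ∘L
    ((ContinuousLinearMap.mul ℂ ℂ).holderL volume ∞ 2 2 ((memLp_top_negSymbol hlam).toLp _)) ∘L
    (Lp.fourierTransformₗᵢ ℝ ℂ).toContinuousLinearEquiv.toContinuousLinearMap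

theorem fourier_negRes {lam : ℝ} (hlam : 0 < lam) (g : Lp ℂ 2 (volume : Measure ℝ)) :
    (𝓕 (negRes hlam g) : Lp ℂ 2 (volume : Measure ℝ)) =ᵐ[volume]
      fun ξ => (negSymbol lam ξ : ℂ) * (𝓕 g : Lp ℂ 2 (volume : Measure ℝ)) ξ := by
  have h : (𝓕 (negRes hlam g) : Lp ℂ 2 (volume : Measure ℝ)) =
      (ContinuousLinearMap.mul ℂ ℂ).holder 2 ((memLp_top_negSymbol hlam).toLp _) (𝓕 g) :=
    (Lp.fourierTransformₗᵢ ℝ ℂ).apply_symm_apply _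
  rw [h]
  filter_upwards [(ContinuousLinearMap.mul ℂ ℂ).coeFn_holder (r := 2)
    ((memLp_top_negSymbol hlam).toLp _) (𝓕 g : Lp ℂ 2 (volume : Measure ℝ)),
    (memLp_top_negSymbol hlam).coeFn_toLp] with ξ h1 h2
  rw [h1, h2]
  rfl

/-- The function `ξ ↦ exp (-2πi x ξ) 1_{ξ < 0} / (lam - 2πξ)`. -/
noncomputable def negKernelFun (lam x ξ : ℝ) : ℂ := (Real.fourierChar (-(ξ * x)) : ℂ) * negSymbol lam ξ

theorem norm_negKernelFun (lam x ξ : ℝ) : ‖negKernelFun lam x ξ‖ = |negSymbol lam ξ| := by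
  rw [negKernelFun, norm_mul, Complex.norm_real, Real.norm_eq_abs, Circle.norm_coe, one_mul]

theorem memLp_negKernelFun {lam : ℝ} (hlam : 0 < lam) (x : ℝ) :
    MemLp (negKernelFun lam x) 2 := by
  have hm : Measurable (negKernelFun lam x) := by
    refine Measurable.mul ?_ (Complex.measurable_ofReal.comp (measurable_negSymbol lam))
    have : Continuous fun ξ : ℝ => (Real.fourierChar (-(ξ * x)) : ℂ) := by fun_prop
    exact this.measurable
  rw [memLp_two_iff_integrable_sq_norm hm.aestronglyMeasurable]
  refine (integrable_negSymbol_sq hlam).congr (Eventually.of_forall fun ξ => ?_)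
  simp only [norm_negKernelFun, sq_abs]

/-- The vector representing the evaluation at `x` of `negRes` on the Fourier side. -/
noncomputable def negKernel {lam : ℝ} (hlam : 0 < lam) (x : ℝ) : Lp ℂ 2 (volume : Measure ℝ) :=
  (memLp_negKernelFun hlam x).toLp _

/-- The continuous representative of `negRes`. -/
noncomputable def negResFun {lam : ℝ} (hlam : 0 < lam) (g : Lp ℂ 2 (volume : Measure ℝ)) (x : ℝ) :
    ℂ :=
  inner ℂ (negKernel hlam x) (𝓕 g)

theorem integrable_negSymbol_mul {lam : ℝ} (hlam : 0 < lam) (a : Lp ℂ 2 (volume : Measure ℝ)) :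
    Integrable (fun ξ => (negSymbol lam ξ : ℂ) * a ξ) := by
  have h : MemLp (fun ξ => (negSymbol lam ξ : ℂ)) 2 := by
    have := memLp_negKernelFun hlam 0
    unfold negKernelFun at this
    simpa [Real.fourierChar_apply] using this
  exact h.integrable_mul (Lp.memLp a)

theorem negResFun_eq_fourierInv {lam : ℝ} (hlam : 0 < lam) (g : Lp ℂ 2 (volume : Measure ℝ)) :
    negResFun hlam g =
      𝓕⁻ (fun ξ => (negSymbol lam ξ : ℂ) * (𝓕 g : Lp ℂ 2 (volume : Measure ℝ)) ξ) := by
  ext x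
  rw [negResFun, L2.inner_def, Real.fourierInv_eq']
  refine integral_congr_ae ?_
  filter_upwards [(memLp_negKernelFun hlam x).coeFn_toLp] with ξ hξ
  rw [negKernel, hξ, negKernelFun, Real.fourierChar_apply]
  simp only [RCLike.inner_apply, map_mul, Complex.conj_ofReal, ← Complex.exp_conj, smul_eq_mul]
  rw [mul_comm, mul_assoc]
  congr 2
  simp
  ring

theorem negRes_ae_eq {lam : ℝ} (hlam : 0 < lam) (g : Lp ℂ 2 (volume : Measure ℝ)) :
    negRes hlam g =ᵐ[volume] negResFun hlam g := by
  have h1 := integrable_negSymbol_mul hlam (𝓕 g)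
  have h2 : MemLp (fun ξ => (negSymbol lam ξ : ℂ) * (𝓕 g : Lp ℂ 2 (volume : Measure ℝ)) ξ) 2 :=
    (Lp.memLp (𝓕 (negRes hlam g))).ae_eq (fourier_negRes hlam g)
  have h3 := fourierInv_toLp_ae_eq h1 h2
  have h4 : h2.toLp _ = 𝓕 (negRes hlam g) := by
    apply Lp.ext
    exact h2.coeFn_toLp.trans (fourier_negRes hlam g).symm
  rw [h4, FourierTransform.fourierInv_fourier_eq] at h3
  rw [negResFun_eq_fourierInv]
  exact h3

theorem continuous_fourierInv_of_integrable {f : ℝ → ℂ} (hf : Integrable f) :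
    Continuous (𝓕⁻ f) := by
  rw [Real.fourierInv_eq_fourier_comp_neg]
  exact continuous_fourier_of_integrable hf.comp_neg

theorem continuous_negResFun {lam : ℝ} (hlam : 0 < lam) (g : Lp ℂ 2 (volume : Measure ℝ)) :
    Continuous (negResFun hlam g) := by
  rw [negResFun_eq_fourierInv]
  exact continuous_fourierInv_of_integrable (integrable_negSymbol_mul hlam _)

/-- Riemann–Lebesgue: the symbol times `𝓕 g` is a product of two `L²` functions, hence integrable.
-/
theorem tendsto_negResFun {lam : ℝ} (hlam : 0 < lam) (g : Lp ℂ 2 (volume : Measure ℝ)) :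
    Tendsto (negResFun hlam g) (cocompact ℝ) (𝓝 0) := by
  rw [negResFun_eq_fourierInv, Real.fourierInv_eq_fourier_comp_neg]
  exact Real.zero_at_infty_fourier _

theorem norm_negKernel {lam : ℝ} (hlam : 0 < lam) (x : ℝ) :
    ‖negKernel hlam x‖ = ‖negKernel hlam 0‖ := by
  rw [negKernel, negKernel, Lp.norm_toLp, Lp.norm_toLp]
  congr 1
  refine eLpNorm_congr_norm_ae (Eventually.of_forall fun ξ => ?_)
  simp only [norm_negKernelFun]

theorem inner_negKernel {lam : ℝ} (hlam : 0 < lam) (x y : ℝ) :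
    inner ℂ (negKernel hlam x) (negKernel hlam y) =
      𝓕⁻ (fun ξ => ((negSymbol lam ξ ^ 2 : ℝ) : ℂ)) (x - y) := by
  rw [L2.inner_def, Real.fourierInv_eq']
  refine integral_congr_ae ?_
  filter_upwards [(memLp_negKernelFun hlam x).coeFn_toLp,
    (memLp_negKernelFun hlam y).coeFn_toLp] with ξ h1 h2
  rw [negKernel, h1, negKernel, h2, negKernelFun, negKernelFun, Real.fourierChar_apply,
    Real.fourierChar_apply]
  simp only [RCLike.inner_apply, map_mul, Complex.conj_ofReal, ← Complex.exp_conj, smul_eq_mul]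
  rw [show ∀ a b c : ℂ, a * b * (c * b) = (a * c) * (b ^ 2) by intros; ring, ← Complex.exp_add]
  push_cast
  congr 2
  simp
  ring

/-- With `G` the inverse transform of the squared symbol, the Gram identity gives `‖k_x - k_y‖² = 2
G(0) - 2 Re G(x - y)`, and `G` is continuous. Norm continuity supplies the strong measurability
needed for the Hilbert–Schmidt operator. -/
theorem continuous_negKernel {lam : ℝ} (hlam : 0 < lam) : Continuous (negKernel hlam) := by
  rw [continuous_iff_continuousAt]
  intro y
  have hG := continuous_fourierInv_of_integrable (integrable_negSymbol_sq hlam).ofReal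
  set G := 𝓕⁻ (fun ξ => ((negSymbol lam ξ ^ 2 : ℝ) : ℂ)) with hGdef
  have e : ∀ x, ‖negKernel hlam x - negKernel hlam y‖ = √(2 * (G 0).re - 2 * (G (x - y)).re) := by
    intro x
    have h0 : ∀ z, ‖negKernel hlam z‖ ^ 2 = (G 0).re := by
      intro z
      rw [← inner_self_eq_norm_sq (𝕜 := ℂ), inner_negKernel, sub_self]
      rfl
    rw [← Real.sqrt_sq (norm_nonneg (negKernel hlam x - negKernel hlam y)),
      norm_sub_sq (𝕜 := ℂ), h0, h0, inner_negKernel]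
    congr 1
    change _ - 2 * (G (x - y)).re + _ = _
    ring
  rw [ContinuousAt, tendsto_iff_norm_sub_tendsto_zero]
  simp only [e]
  have : Continuous fun x => √(2 * (G 0).re - 2 * (G (x - y)).re) := by
    refine (continuous_const.sub (continuous_const.mul (Complex.continuous_re.comp
      (hG.comp (continuous_id.sub continuous_const))))).sqrt
  simpa using this.tendsto y

/-! ### The Jost equation and its equivalence with the eigenvalue equation. -/

/-- The character `x ↦ exp (i lam x)`. -/
noncomputable def wave (lam x : ℝ) : ℂ := Complex.exp (Complex.I * lam * x)

theorem continuous_wave (lam : ℝ) : Continuous (wave lam) := by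
  unfold wave; fun_prop

theorem hasDerivAt_wave (lam x : ℝ) :
    HasDerivAt (wave lam) (wave lam x * (Complex.I * lam)) x := by
  have e1 : HasDerivAt (fun x : ℝ => Complex.I * lam * x) (Complex.I * lam) x := by
    simpa using (hasDerivAt_id x).ofReal_comp.const_mul (Complex.I * lam)
  exact e1.cexp

@[simp] theorem norm_wave (lam x : ℝ) : ‖wave lam x‖ = 1 := by
  rw [wave, show Complex.I * lam * x = ((lam * x : ℝ) : ℂ) * Complex.I by push_cast; ring,
    Complex.norm_exp_ofReal_mul_I]

theorem star_wave (lam x : ℝ) : star (wave lam x) = wave (-lam) x := by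
  rw [wave, wave, Complex.star_def, ← Complex.exp_conj]
  simp

theorem wave_mul_wave_neg (lam x : ℝ) : wave lam x * wave (-lam) x = 1 := by
  rw [wave, wave, ← Complex.exp_add]
  simp

theorem wave_neg_mul_wave (lam x : ℝ) : wave (-lam) x * wave lam x = 1 := by
  rw [mul_comm, wave_mul_wave_neg]

theorem Integrable.wave_mul {f : ℝ → ℂ} (hf : Integrable f) (lam : ℝ) :
    Integrable (fun x => wave lam x * f x) :=
  hf.bdd_mul (c := 1) (continuous_wave lam).aestronglyMeasurable
    (Eventually.of_forall fun x => (norm_wave lam x).le)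

/-- The amplitude `c + i ∫_{-∞}^x exp (-i lam y) g y dy`. -/
noncomputable def amplitude (lam : ℝ) (c : ℂ) (g : ℝ → ℂ) (x : ℝ) : ℂ :=
  c + ∫ y in Set.Iic x, Complex.I * (wave (-lam) y * g y)

/-- The general bounded solution of `-i m' - lam m = Π g`. -/
noncomputable def jost {lam : ℝ} (hlam : 0 < lam) (c : ℂ) (g : Lp ℂ 2 (volume : Measure ℝ))
    (x : ℝ) : ℂ :=
  wave lam x * amplitude lam c g x + negResFun hlam g x

section amplitude

variable {lam : ℝ} {g : ℝ → ℂ}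

theorem integrable_I_wave (hg : Integrable g) :
    Integrable (fun y => Complex.I * (wave (-lam) y * g y)) :=
  (Integrable.wave_mul hg _).const_mul _

theorem isPrimitive_amplitude (hg : Integrable g) (c : ℂ) :
    IsPrimitive (amplitude lam c g) (fun y => Complex.I * (wave (-lam) y * g y)) :=
  (isPrimitive_integral_Iic (integrable_I_wave hg)).const_add c

theorem continuous_amplitude (hg : Integrable g) (c : ℂ) : Continuous (amplitude lam c g) :=
  (isPrimitive_amplitude hg c).continuous

theorem tendsto_amplitude_atBot (hg : Integrable g) (c : ℂ) :
    Tendsto (amplitude lam c g) atBot (𝓝 c) := by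
  have h := (tendsto_integral_Iic_atBot (integrable_I_wave (lam := lam) hg)).const_add c
  rwa [add_zero] at h

theorem tendsto_amplitude_atTop (hg : Integrable g) (c : ℂ) :
    Tendsto (amplitude lam c g) atTop
      (𝓝 (c + ∫ y, Complex.I * (wave (-lam) y * g y))) :=
  (tendsto_integral_Iic_atTop (integrable_I_wave (lam := lam) hg)).const_add c

theorem norm_amplitude_le (hg : Integrable g) (c : ℂ) (x : ℝ) :
    ‖amplitude lam c g x‖ ≤ ‖c‖ + ∫ y, ‖g y‖ := by
  refine (norm_add_le _ _).trans (add_le_add le_rfl ?_)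
  refine (norm_integral_Iic_le (integrable_I_wave hg) x).trans_eq ?_
  simp

end amplitude

theorem norm_negResFun_le {lam : ℝ} (hlam : 0 < lam) (g : Lp ℂ 2 (volume : Measure ℝ)) (x : ℝ) :
    ‖negResFun hlam g x‖ ≤ ‖negKernel hlam 0‖ * ‖g‖ := by
  refine (norm_inner_le_norm _ _).trans_eq ?_
  rw [norm_negKernel, Lp.norm_fourier_eq]

theorem continuous_jost {lam : ℝ} (hlam : 0 < lam) (c : ℂ) (g : Lp ℂ 2 (volume : Measure ℝ))
    (hg : Integrable g) : Continuous (jost hlam c g) :=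
  ((continuous_wave lam).mul (continuous_amplitude hg c)).add (continuous_negResFun hlam g)

theorem norm_jost_le {lam : ℝ} (hlam : 0 < lam) (c : ℂ) (g : Lp ℂ 2 (volume : Measure ℝ))
    (hg : Integrable g) (x : ℝ) :
    ‖jost hlam c g x‖ ≤ ‖c‖ + (∫ y, ‖g y‖) + ‖negKernel hlam 0‖ * ‖g‖ := by
  refine (norm_add_le _ _).trans (add_le_add ?_ (norm_negResFun_le hlam g x))
  rw [norm_mul, norm_wave, one_mul]
  exact norm_amplitude_le hg c x

theorem memLp_top_jost {lam : ℝ} (hlam : 0 < lam) (c : ℂ) (g : Lp ℂ 2 (volume : Measure ℝ))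
    (hg : Integrable g) : MemLp (jost hlam c g) ∞ :=
  memLp_top_of_bound (continuous_jost hlam c g hg).aestronglyMeasurable _
    (Eventually.of_forall (norm_jost_le hlam c g hg))

/-- The formal transpose of `-i ∂ₓ - lam`. -/
noncomputable def transposeOp (lam : ℝ) (φ : 𝓢(ℝ, ℂ)) : 𝓢(ℝ, ℂ) :=
  Complex.I • SchwartzMap.derivCLM ℂ ℂ φ - (lam : ℂ) • φ

theorem transposeOp_apply (lam : ℝ) (φ : 𝓢(ℝ, ℂ)) (x : ℝ) :
    transposeOp lam φ x = Complex.I * deriv φ x - lam * φ x := by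
  rw [transposeOp, sub_apply, smul_apply, smul_apply, SchwartzMap.derivCLM_apply]
  rfl

/-- The inverse transform appears because `∫ φ f` pairs `𝓕⁻ φ` with `𝓕 f`; on that side `-i ∂ₓ -
lam` has symbol `2πξ - lam`. -/
theorem fourierInv_transposeOp (lam : ℝ) (φ : 𝓢(ℝ, ℂ)) :
    𝓕⁻ (transposeOp lam φ) =
      SchwartzMap.smulLeftCLM ℂ (fun ξ : ℝ => ((2 * Real.pi * ξ - lam : ℝ) : ℂ)) (𝓕⁻ φ) := by
  ext ξ
  have hadd : 𝓕⁻ (Complex.I • SchwartzMap.derivCLM ℂ ℂ φ - (lam : ℂ) • φ) =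
      Complex.I • 𝓕⁻ (SchwartzMap.derivCLM ℂ ℂ φ) - (lam : ℂ) • 𝓕⁻ φ := by
    rw [sub_eq_add_neg, ← neg_smul, FourierTransform.fourierInv_add,
      FourierTransform.fourierInv_smul, FourierTransform.fourierInv_smul, neg_smul,
      ← sub_eq_add_neg]
  rw [SchwartzMap.smulLeftCLM_apply_apply (hasTemperateGrowth_linear lam), transposeOp, hadd,
    sub_apply, smul_apply, smul_apply]
  have h : (𝓕⁻ (SchwartzMap.derivCLM ℂ ℂ φ)) ξ = -(2 * Real.pi * Complex.I * ξ) * (𝓕⁻ φ) ξ := by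
    have h1 := congrFun (Real.fourier_deriv φ.integrable φ.differentiable
      (SchwartzMap.derivCLM ℂ ℂ φ).integrable) (-ξ)
    rw [SchwartzMap.fourierInv_coe, SchwartzMap.fourierInv_coe, Real.fourierInv_eq_fourier_neg,
      Real.fourierInv_eq_fourier_neg]
    refine h1.trans ?_
    simp
  rw [h]
  simp only [smul_eq_mul]
  push_cast
  linear_combination (-2 * Real.pi * ξ * (𝓕⁻ φ) ξ) * Complex.I_sq

/-- Integrate the derivative of amplitude times `wave * φ` over the line. The amplitude is bounded
and `φ` decays, so there are no boundary terms, whatever the constant `c`. -/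
theorem integral_transposeOp_wave_mul_amplitude {lam : ℝ} (c : ℂ) {g : ℝ → ℂ} (hg : Integrable g)
    (φ : 𝓢(ℝ, ℂ)) :
    ∫ x, transposeOp lam φ x * (wave lam x * amplitude lam c g x) = ∫ x, φ x * g x := by
  have hφ : ∀ x, HasDerivAt (fun x => wave lam x * φ x)
      (wave lam x * (Complex.I * lam) * φ x + wave lam x * deriv φ x) x := fun x =>
    (hasDerivAt_wave lam x).mul φ.differentiableAt.hasDerivAt
  have cφ' : Continuous (deriv φ) := (SchwartzMap.derivCLM ℂ ℂ φ).continuous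
  have cw := continuous_wave lam
  have hP := (isPrimitive_amplitude (lam := lam) hg c).mul (IsPrimitive.of_hasDerivAt hφ
    (((cw.mul continuous_const).mul φ.continuous).add (cw.mul cφ')))
  have i1 : Integrable (fun x => φ x * g x) :=
    hg.bdd_mul (c := ‖φ.toBoundedContinuousFunction‖) φ.continuous.aestronglyMeasurable
      (Eventually.of_forall fun x => φ.toBoundedContinuousFunction.norm_coe_le_norm x)
  have i2 : Integrable (fun x => transposeOp lam φ x * (wave lam x * amplitude lam c g x)) :=
    (transposeOp lam φ).integrable.mul_bdd (c := ‖c‖ + ∫ y, ‖g y‖)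
      (cw.mul (continuous_amplitude hg c)).aestronglyMeasurable
      (Eventually.of_forall fun x => by
        rw [norm_mul, norm_wave, one_mul]; exact norm_amplitude_le hg c x)
  have hpt : ∀ x, Complex.I * (wave (-lam) x * g x) * (wave lam x * φ x) +
      amplitude lam c g x * (wave lam x * (Complex.I * lam) * φ x + wave lam x * deriv φ x) =
      Complex.I * (φ x * g x) -
        Complex.I * (transposeOp lam φ x * (wave lam x * amplitude lam c g x)) := by
    intro x
    rw [transposeOp_apply]
    linear_combination (Complex.I * g x * φ x) * wave_neg_mul_wave lam x +
      (deriv φ x * wave lam x * amplitude lam c g x) * Complex.I_sq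
  have hi := (i1.const_mul Complex.I).sub (i2.const_mul Complex.I)
  have hz : ∀ l : Filter ℝ, l ≤ cocompact ℝ →
      Tendsto (fun x => amplitude lam c g x * (wave lam x * φ x)) l (𝓝 0) := by
    intro l hl
    have h0 : Tendsto (fun x => (‖c‖ + ∫ y, ‖g y‖) * ‖φ x‖) l (𝓝 0) := by
      have := (φ.toZeroAtInfty.zero_at_infty'.mono_left hl).norm.const_mul (‖c‖ + ∫ y, ‖g y‖)
      simpa using this
    refine squeeze_zero_norm (fun x => ?_) h0
    rw [norm_mul, norm_mul, norm_wave, one_mul]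
    exact mul_le_mul_of_nonneg_right (norm_amplitude_le hg c x) (norm_nonneg _)
  have h := hP.integral_eq_of_tendsto (hi.congr (Eventually.of_forall fun x => (hpt x).symm))
    (hz _ atBot_le_cocompact) (hz _ atTop_le_cocompact)
  simp only [hpt] at h
  rw [integral_sub (i1.const_mul _) (i2.const_mul _), integral_const_mul, integral_const_mul,
    ← mul_sub, sub_zero] at h
  exact (sub_eq_zero.1 ((mul_eq_zero.1 h).resolve_left Complex.I_ne_zero)).symm

theorem integrable_schwartz_mul_L2 (φ : 𝓢(ℝ, ℂ)) (a : Lp ℂ 2 (volume : Measure ℝ)) :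
    Integrable (fun x => φ x * a x) :=
  (φ.memLp 2 volume).integrable_mul (Lp.memLp a)

theorem integral_schwartz_mul_szego (φ : 𝓢(ℝ, ℂ)) (g : Lp ℂ 2 (volume : Measure ℝ)) :
    ∫ x, φ x * szego g x =
      ∫ ξ, (𝓕⁻ φ) ξ * (Set.Ici (0 : ℝ)).indicator (𝓕 g : Lp ℂ 2 (volume : Measure ℝ)) ξ := by
  have h := integral_smul_fourierInv_L2 (𝓕 (szego g)) φ
  rw [FourierTransform.fourierInv_fourier_eq, fourier_szego] at h
  simp only [smul_eq_mul] at h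
  rw [h]
  refine integral_congr_ae ?_
  filter_upwards [coeFn_cutoff measurableSet_Ici (𝓕 g)] with ξ hξ
  rw [hξ]

/-- On the Fourier side `(2πξ - lam)` times the symbol is `-1` for `ξ < 0` and `0` otherwise, which
is the multiplier of `Π - 1`. -/
theorem integral_transposeOp_negResFun {lam : ℝ} (hlam : 0 < lam)
    (g : Lp ℂ 2 (volume : Measure ℝ)) (φ : 𝓢(ℝ, ℂ)) :
    ∫ x, transposeOp lam φ x * negResFun hlam g x =
      (∫ x, φ x * szego g x) - ∫ x, φ x * g x := by
  have h1 : ∫ x, transposeOp lam φ x * negResFun hlam g x =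
      ∫ ξ, (𝓕⁻ (transposeOp lam φ)) ξ *
        ((negSymbol lam ξ : ℂ) * (𝓕 g : Lp ℂ 2 (volume : Measure ℝ)) ξ) := by
    have h := integral_smul_fourierInv_L2 (𝓕 (negRes hlam g)) (transposeOp lam φ)
    rw [FourierTransform.fourierInv_fourier_eq] at h
    simp only [smul_eq_mul] at h
    refine Eq.trans (integral_congr_ae ?_) (h.trans (integral_congr_ae ?_))
    · filter_upwards [negRes_ae_eq hlam g] with x hx
      rw [hx]
    · filter_upwards [fourier_negRes hlam g] with x hx
      rw [hx]
  have h2 : ∫ x, φ x * g x = ∫ ξ, (𝓕⁻ φ) ξ * (𝓕 g : Lp ℂ 2 (volume : Measure ℝ)) ξ := by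
    have h := integral_smul_fourierInv_L2 (𝓕 g) φ
    rw [FourierTransform.fourierInv_fourier_eq] at h
    simpa only [smul_eq_mul] using h
  have i3 : Integrable (fun ξ => (𝓕⁻ φ) ξ *
      (Set.Ici (0 : ℝ)).indicator (𝓕 g : Lp ℂ 2 (volume : Measure ℝ)) ξ) := by
    have := (integrable_schwartz_mul_L2 (𝓕⁻ φ) (𝓕 g)).indicator (measurableSet_Ici (a := (0 : ℝ)))
    refine this.congr (Eventually.of_forall fun ξ => ?_)
    by_cases h : ξ ∈ Set.Ici (0 : ℝ) <;> simp [h]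
  rw [h1, h2, integral_schwartz_mul_szego, ← integral_sub i3 (integrable_schwartz_mul_L2 _ _)]
  refine integral_congr_ae (Eventually.of_forall fun ξ => ?_)
  beta_reduce
  rw [fourierInv_transposeOp, SchwartzMap.smulLeftCLM_apply_apply (hasTemperateGrowth_linear lam),
    smul_eq_mul]
  by_cases h : ξ < 0
  · rw [Set.indicator_of_notMem (by simpa using h)]
    have := sub_mul_negSymbol hlam h
    have h' : ((2 * Real.pi * ξ - lam : ℝ) : ℂ) * (negSymbol lam ξ : ℂ) = -1 := by
      exact_mod_cast this
    linear_combination ((𝓕⁻ φ) ξ * (𝓕 g : Lp ℂ 2 (volume : Measure ℝ)) ξ) * h'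
  · rw [Set.indicator_of_mem (by simpa using h), negSymbol, if_neg h]
    simp

theorem integral_transposeOp_jost {lam : ℝ} (hlam : 0 < lam) (c : ℂ)
    (g : Lp ℂ 2 (volume : Measure ℝ)) (hg : Integrable g) (φ : 𝓢(ℝ, ℂ)) :
    ∫ x, transposeOp lam φ x * jost hlam c g x = ∫ x, φ x * szego g x := by
  have i1 : Integrable (fun x => transposeOp lam φ x * (wave lam x * amplitude lam c g x)) :=
    (transposeOp lam φ).integrable.mul_bdd (c := ‖c‖ + ∫ y, ‖g y‖)
      ((continuous_wave lam).mul (continuous_amplitude hg c)).aestronglyMeasurable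
      (Eventually.of_forall fun x => by
        rw [norm_mul, norm_wave, one_mul]; exact norm_amplitude_le hg c x)
  have i2 : Integrable (fun x => transposeOp lam φ x * negResFun hlam g x) :=
    (transposeOp lam φ).integrable.mul_bdd (continuous_negResFun hlam g).aestronglyMeasurable
      (Eventually.of_forall fun x => norm_negResFun_le hlam g x)
  simp only [jost, mul_add]
  rw [integral_add i1 i2, integral_transposeOp_wave_mul_amplitude c hg,
    integral_transposeOp_negResFun]
  ring

/-- A test function `φ` supported in negative frequencies is `(2πξ - lam) ψ` with `ψ` of the same
kind. Pairing `φ` with the transform of `m` therefore amounts to pairing `ψ` with that of `(-i ∂ₓ -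
lam) m = Π g`, which gives zero. -/
theorem mem_hardy_top_of_ae_eq_jost {lam : ℝ} (hlam : 0 < lam) (c : ℂ)
    (g : Lp ℂ 2 (volume : Measure ℝ)) (hg : Integrable g) (m : Lp ℂ ∞ (volume : Measure ℝ))
    (hm : m =ᵐ[volume] jost hlam c g) : m ∈ hardy ∞ := by
  intro φ hφ
  obtain ⟨ψ, hψ, hψφ⟩ := exists_schwartz_div hlam φ hφ
  have h1 : 𝓕 φ = transposeOp lam (𝓕 ψ) := by
    have := fourierInv_transposeOp lam (𝓕 ψ)
    rw [FourierTransform.fourierInv_fourier_eq, hψφ] at this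
    rw [← this, FourierTransform.fourier_fourierInv_eq]
  rw [TemperedDistribution.fourier_apply, Lp.toTemperedDistribution_apply, h1]
  have h2 : ∫ x, transposeOp lam (𝓕 ψ) x • m x =
      ∫ x, transposeOp lam (𝓕 ψ) x * jost hlam c g x := by
    refine integral_congr_ae ?_
    filter_upwards [hm] with x hx
    rw [hx, smul_eq_mul]
  rw [h2, integral_transposeOp_jost hlam c g hg, integral_schwartz_mul_szego,
    FourierTransform.fourierInv_fourier_eq]
  refine integral_eq_zero_of_ae (Eventually.of_forall fun ξ => ?_)
  by_cases h : ξ < 0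
  · simp [h]
  · simp [(eventuallyEq_zero_of_tsupport_subset hψ (x := ξ) h).eq_of_nhds]

theorem mem_genEigenspace_iff_integral (u : Lp ℝ 2 (volume : Measure ℝ)) (lam : ℝ) (m : hardy ∞) :
    m ∈ genEigenspace u lam ↔ ∀ φ : 𝓢(ℝ, ℂ),
      ∫ x, transposeOp lam φ x * (m : Lp ℂ ∞ (volume : Measure ℝ)) x =
        ∫ x, φ x * szego (u • (m : Lp ℂ ∞ (volume : Measure ℝ)) :
          Lp ℂ 2 (volume : Measure ℝ)) x := by
  have bd : ∀ φ : 𝓢(ℝ, ℂ), Integrable (fun x => φ x * (m : Lp ℂ ∞ (volume : Measure ℝ)) x) :=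
    fun φ => (φ.memLp 1 volume).integrable_mul (Lp.memLp (m : Lp ℂ ∞ (volume : Measure ℝ)))
  have key : ∀ φ : 𝓢(ℝ, ℂ), (lax u - (lam : ℂ) • hardyToDistribution) m φ =
      (∫ x, transposeOp lam φ x * (m : Lp ℂ ∞ (volume : Measure ℝ)) x) -
        ∫ x, φ x * szego (u • (m : Lp ℂ ∞ (volume : Measure ℝ)) :
          Lp ℂ 2 (volume : Measure ℝ)) x := by
    intro φ
    have e1 : (lax u - (lam : ℂ) • hardyToDistribution) m φ =
        (-Complex.I) * ((m : Lp ℂ ∞ (volume : Measure ℝ)) : 𝓢'(ℝ, ℂ)) (-SchwartzMap.derivCLM ℂ ℂ φ)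
        - ((szego (u • (m : Lp ℂ ∞ (volume : Measure ℝ)) :
          Lp ℂ 2 (volume : Measure ℝ)) : Lp ℂ 2 (volume : Measure ℝ)) : 𝓢'(ℝ, ℂ)) φ
        - lam * ((m : Lp ℂ ∞ (volume : Measure ℝ)) : 𝓢'(ℝ, ℂ)) φ := rfl
    rw [e1, map_neg]
    simp only [Lp.toTemperedDistribution_apply, smul_eq_mul]
    have e2 : ∫ x, transposeOp lam φ x * (m : Lp ℂ ∞ (volume : Measure ℝ)) x =
        Complex.I * (∫ x, (SchwartzMap.derivCLM ℂ ℂ φ) x * (m : Lp ℂ ∞ (volume : Measure ℝ)) x)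
          - lam * ∫ x, φ x * (m : Lp ℂ ∞ (volume : Measure ℝ)) x := by
      rw [← integral_const_mul, ← integral_const_mul,
        ← integral_sub ((bd _).const_mul _) ((bd _).const_mul _)]
      refine integral_congr_ae (Eventually.of_forall fun x => ?_)
      beta_reduce
      rw [transposeOp_apply, SchwartzMap.derivCLM_apply]
      ring
    rw [e2]
    ring
  constructor
  · intro h φ
    have h1 : (lax u - (lam : ℂ) • hardyToDistribution) m = 0 := h
    have h2 := key φ
    rw [h1] at h2
    exact sub_eq_zero.1 h2.symm
  · intro h
    change (lax u - (lam : ℂ) • hardyToDistribution) m = 0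
    ext φ
    rw [key, h φ, sub_self]
    rfl

/-- The elements of the generalised eigenspace are the fixed points of the Jost equation. -/
theorem mem_genEigenspace_iff (u : Lp ℝ 2 (volume : Measure ℝ)) {lam : ℝ} (hlam : 0 < lam)
    (m : hardy ∞) (hg : Integrable (u • (m : Lp ℂ ∞ (volume : Measure ℝ)) :
      Lp ℂ 2 (volume : Measure ℝ))) :
    m ∈ genEigenspace u lam ↔ ∃ c : ℂ, (m : Lp ℂ ∞ (volume : Measure ℝ)) =ᵐ[volume]
      jost hlam c (u • (m : Lp ℂ ∞ (volume : Measure ℝ)) : Lp ℂ 2 (volume : Measure ℝ)) := by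
  rw [mem_genEigenspace_iff_integral]
  set g : Lp ℂ 2 (volume : Measure ℝ) := u • (m : Lp ℂ ∞ (volume : Measure ℝ))
  constructor
  · intro h
    have hl : LocallyIntegrable (m : Lp ℂ ∞ (volume : Measure ℝ)) :=
      (Lp.memLp (m : Lp ℂ ∞ (volume : Measure ℝ))).locallyIntegrable le_top
    have hj := (continuous_jost hlam 0 g hg).locallyIntegrable (μ := volume)
    -- The difference from the particular solution with amplitude `0` at `-∞` solves the homogeneous
    -- equation; its coefficient is the sought `c`.
    obtain ⟨c, hc⟩ := ae_eq_exp_of_weak_solution lam (hl.sub hj) (fun φ => by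
      have i1 : Integrable (fun x => transposeOp lam φ x *
          (m : Lp ℂ ∞ (volume : Measure ℝ)) x) :=
        ((transposeOp lam φ).memLp 1 volume).integrable_mul
          (Lp.memLp (m : Lp ℂ ∞ (volume : Measure ℝ)))
      have i2 : Integrable (fun x => transposeOp lam φ x * jost hlam 0 g x) :=
        ((transposeOp lam φ).memLp 1 volume).integrable_mul (memLp_top_jost hlam 0 g hg)
      simp only [← transposeOp_apply, Pi.sub_apply, mul_sub]
      rw [integral_sub i1 i2, h φ, integral_transposeOp_jost hlam 0 g hg, sub_self])
    refine ⟨c, ?_⟩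
    filter_upwards [hc] with x hx
    rw [Pi.sub_apply, sub_eq_iff_eq_add] at hx
    rw [hx, jost, jost, amplitude, amplitude, wave]
    ring
  · rintro ⟨c, hc⟩ φ
    rw [← integral_transposeOp_jost hlam c g hg]
    refine integral_congr_ae ?_
    filter_upwards [hc] with x hx
    rw [hx]

/-! ### Quadratic identities: the resolvent inequality and conservation of modulus. -/

theorem norm_sq_L2 (a : Lp ℂ 2 (volume : Measure ℝ)) : ‖a‖ ^ 2 = ∫ x, ‖a x‖ ^ 2 := by
  have h := congrArg Complex.re (L2.inner_def (𝕜 := ℂ) a a)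
  rw [inner_self_eq_norm_sq_to_K] at h
  have h2 : ∫ x, inner ℂ (a x) (a x) = ((∫ x, ‖a x‖ ^ 2 : ℝ) : ℂ) := by
    rw [← integral_complex_ofReal]
    refine integral_congr_ae (Eventually.of_forall fun x => ?_)
    beta_reduce
    rw [inner_self_eq_norm_sq_to_K]
    push_cast
    rfl
  rw [h2, Complex.ofReal_re] at h
  rw [← h]
  norm_cast

theorem inner_negRes {lam : ℝ} (hlam : 0 < lam) (g b : Lp ℂ 2 (volume : Measure ℝ)) :
    inner ℂ (negRes hlam g) b = ∫ ξ, (negSymbol lam ξ : ℂ) *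
      ((𝓕 b : Lp ℂ 2 (volume : Measure ℝ)) ξ *
        star ((𝓕 g : Lp ℂ 2 (volume : Measure ℝ)) ξ)) := by
  rw [← Lp.inner_fourier_eq, L2.inner_def]
  refine integral_congr_ae ?_
  filter_upwards [fourier_negRes hlam g] with ξ hξ
  rw [hξ]
  simp only [RCLike.inner_apply, map_mul, Complex.conj_ofReal, Complex.star_def]
  ring

theorem im_inner_negRes_self {lam : ℝ} (hlam : 0 < lam) (g : Lp ℂ 2 (volume : Measure ℝ)) :
    (inner ℂ (negRes hlam g) g).im = 0 := by
  rw [inner_negRes]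
  have : ∀ ξ, (negSymbol lam ξ : ℂ) * ((𝓕 g : Lp ℂ 2 (volume : Measure ℝ)) ξ *
        star ((𝓕 g : Lp ℂ 2 (volume : Measure ℝ)) ξ)) =
      ((negSymbol lam ξ * ‖(𝓕 g : Lp ℂ 2 (volume : Measure ℝ)) ξ‖ ^ 2 : ℝ) : ℂ) := by
    intro ξ
    rw [Complex.star_def, Complex.mul_conj']
    push_cast
    rfl
  simp only [this]
  rw [integral_complex_ofReal, Complex.ofReal_im]

theorem norm_sq_negRes {lam : ℝ} (hlam : 0 < lam) (g : Lp ℂ 2 (volume : Measure ℝ)) :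
    ‖negRes hlam g‖ ^ 2 =
      ∫ ξ, negSymbol lam ξ ^ 2 * ‖(𝓕 g : Lp ℂ 2 (volume : Measure ℝ)) ξ‖ ^ 2 := by
  rw [← Lp.norm_fourier_eq, norm_sq_L2]
  refine integral_congr_ae ?_
  filter_upwards [fourier_negRes hlam g] with ξ hξ
  rw [hξ, norm_mul, mul_pow, Complex.norm_real, Real.norm_eq_abs, sq_abs]

theorem integrable_negSymbol_mul_mul {lam : ℝ} (hlam : 0 < lam)
    (a b : Lp ℂ 2 (volume : Measure ℝ)) :
    Integrable (fun ξ => (negSymbol lam ξ : ℂ) * (a ξ * star (b ξ))) :=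
  Integrable.bdd_mul (c := lam⁻¹) ((Lp.memLp a).integrable_mul (Lp.memLp b).star)
    (Complex.measurable_ofReal.comp (measurable_negSymbol lam)).aestronglyMeasurable
    (Eventually.of_forall fun ξ => by
      rw [Complex.norm_real, Real.norm_of_nonneg (negSymbol_nonneg hlam ξ)]
      exact negSymbol_le hlam ξ)

/-- The integral of the derivative of `|F|² / (lam - 2πξ)` over `(-∞, 0]`, with `F = 𝓕 f`, is `2π
(‖N‖² + 2 Im ⟨N, x f⟩)`. It is also the boundary value `|F(0)|² / lam ≥ 0`. Integrability of `f` and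
`x f` makes `F` differentiable everywhere. -/
theorem neg_two_mul_im_inner_negRes_le_aux {lam : ℝ} (hlam : 0 < lam) {f : ℝ → ℂ}
    (h1 : Integrable f) (h2 : MemLp f 2) (h3 : Integrable (fun x : ℝ => (x : ℂ) * f x))
    (h4 : MemLp (fun x : ℝ => (x : ℂ) * f x) 2) :
    -2 * (inner ℂ (negRes hlam (h2.toLp f)) (h4.toLp _)).im ≤
      ‖negRes hlam (h2.toLp f)‖ ^ 2 := by
  set F : ℝ → ℂ := 𝓕 f with hF
  set X : ℝ → ℂ := 𝓕 (fun x : ℝ => (x : ℂ) * f x) with hX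
  have eF : (𝓕 (h2.toLp f) : Lp ℂ 2 (volume : Measure ℝ)) =ᵐ[volume] F := fourier_toLp_ae_eq h1 h2
  have eX : (𝓕 (h4.toLp _) : Lp ℂ 2 (volume : Measure ℝ)) =ᵐ[volume] X := fourier_toLp_ae_eq h3 h4
  have hd : ∀ ξ, HasDerivAt F (-2 * Real.pi * Complex.I * X ξ) ξ := by
    intro ξ
    have h := Real.hasDerivAt_fourier h1 (by simpa using h3) ξ
    refine h.congr_deriv ?_
    rw [hX, Real.fourier_eq', Real.fourier_eq', ← integral_const_mul]
    refine Eq.symm (integral_congr_ae (Eventually.of_forall fun x => ?_))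
    simp only [smul_eq_mul]
    ring
  set P : ℝ → ℝ := fun ξ => (X ξ * star (F ξ)).im with hP
  have iP : Integrable (fun ξ => negSymbol lam ξ * P ξ) := by
    have := (integrable_negSymbol_mul_mul hlam (𝓕 (h4.toLp _)) (𝓕 (h2.toLp f))).im
    refine this.congr ?_
    filter_upwards [eF, eX] with ξ e1 e2
    rw [e1, e2]
    exact Complex.im_ofReal_mul _ _
  have iQ : Integrable (fun ξ => negSymbol lam ξ ^ 2 * ‖F ξ‖ ^ 2) := by
    have h := (Lp.memLp (𝓕 (negRes hlam (h2.toLp f)))).integrable_norm_pow two_ne_zero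
    refine h.congr ?_
    filter_upwards [fourier_negRes hlam (h2.toLp f), eF] with ξ e1 e2
    rw [e1, e2, norm_mul, mul_pow, Complex.norm_real, Real.norm_eq_abs, sq_abs]
  have e1 : (inner ℂ (negRes hlam (h2.toLp f)) (h4.toLp _)).im = ∫ ξ, negSymbol lam ξ * P ξ := by
    rw [inner_negRes]
    have := integral_im (𝕜 := ℂ)
      (integrable_negSymbol_mul_mul hlam (𝓕 (h4.toLp _)) (𝓕 (h2.toLp f)))
    refine this.symm.trans (integral_congr_ae ?_)
    filter_upwards [eF, eX] with ξ e1 e2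
    rw [e1, e2]
    exact Complex.im_ofReal_mul _ _
  have e2 : ‖negRes hlam (h2.toLp f)‖ ^ 2 = ∫ ξ, negSymbol lam ξ ^ 2 * ‖F ξ‖ ^ 2 := by
    rw [norm_sq_negRes]
    refine integral_congr_ae ?_
    filter_upwards [eF] with ξ e1
    rw [e1]
  -- the derivative of `‖F‖² / (lam - 2πξ)` on the negative half-line
  have hne : ∀ ξ : ℝ, ξ ≤ 0 → 0 < lam - 2 * Real.pi * ξ := by
    intro ξ hξ
    have : 2 * Real.pi * ξ ≤ 0 := mul_nonpos_of_nonneg_of_nonpos Real.two_pi_pos.le hξ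
    linarith
  have hΦ : ∀ ξ ∈ Set.Iio (0 : ℝ), HasDerivAt (fun ξ => (lam - 2 * Real.pi * ξ)⁻¹ * ‖F ξ‖ ^ 2)
      (2 * Real.pi * (negSymbol lam ξ ^ 2 * ‖F ξ‖ ^ 2 + 2 * (negSymbol lam ξ * P ξ))) ξ := by
    intro ξ hξ
    have d1 : HasDerivAt (fun ξ : ℝ => lam - 2 * Real.pi * ξ) (-(2 * Real.pi)) ξ := by
      simpa using ((hasDerivAt_id ξ).const_mul (2 * Real.pi)).const_sub lam
    have d2 := (d1.fun_inv (hne ξ (le_of_lt hξ)).ne').mul (hd ξ).norm_sq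
    refine d2.congr_deriv ?_
    have hin : inner ℝ (F ξ) (-2 * Real.pi * Complex.I * X ξ) = 2 * Real.pi * P ξ := by
      rw [hP, Complex.inner]
      simp
      ring
    rw [hin, negSymbol, if_pos (Set.mem_Iio.1 hξ)]
    have := (hne ξ (le_of_lt hξ)).ne'
    field_simp
  have hFc : Continuous F := continuous_fourier_of_integrable h1
  have hlim : Tendsto (fun ξ => (lam - 2 * Real.pi * ξ)⁻¹ * ‖F ξ‖ ^ 2) atBot (𝓝 0) := by
    have hF0 : Tendsto (fun ξ => lam⁻¹ * ‖F ξ‖ ^ 2) atBot (𝓝 0) := by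
      have := (((Real.zero_at_infty_fourier f).mono_left atBot_le_cocompact).norm.pow 2).const_mul
        lam⁻¹
      simpa using this
    refine squeeze_zero' ?_ ?_ hF0
    · filter_upwards [eventually_le_atBot 0] with ξ hξ
      have := hne ξ hξ
      positivity
    · filter_upwards [eventually_le_atBot 0] with ξ hξ
      refine mul_le_mul_of_nonneg_right (inv_anti₀ hlam ?_) (by positivity)
      have : 2 * Real.pi * ξ ≤ 0 := mul_nonpos_of_nonneg_of_nonpos Real.two_pi_pos.le hξ
      linarith
  have iT := (iQ.add (iP.const_mul 2)).const_mul (2 * Real.pi)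
  have hint := integral_Iic_of_hasDerivAt_of_tendsto (a := 0)
    (f := fun ξ => (lam - 2 * Real.pi * ξ)⁻¹ * ‖F ξ‖ ^ 2)
    (by
      refine ContinuousAt.continuousWithinAt (ContinuousAt.mul ?_ (hFc.norm.pow 2).continuousAt)
      exact ContinuousAt.inv₀ (by fun_prop) (hne 0 le_rfl).ne')
    hΦ iT.integrableOn hlim
  have hset : ∫ ξ in Set.Iic (0 : ℝ), 2 * Real.pi *
      (negSymbol lam ξ ^ 2 * ‖F ξ‖ ^ 2 + 2 * (negSymbol lam ξ * P ξ)) =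
      2 * Real.pi * ((∫ ξ, negSymbol lam ξ ^ 2 * ‖F ξ‖ ^ 2) +
        2 * ∫ ξ, negSymbol lam ξ * P ξ) := by
    rw [setIntegral_eq_integral_of_forall_compl_eq_zero, integral_const_mul,
      integral_add iQ (iP.const_mul 2), integral_const_mul]
    intro ξ hξ
    have : ¬ ξ < 0 := fun h => hξ (le_of_lt h)
    simp [negSymbol, this]
  rw [hset] at hint
  rw [e1, e2]
  have hpos : 0 ≤ 2 * Real.pi * ((∫ ξ, negSymbol lam ξ ^ 2 * ‖F ξ‖ ^ 2) +
        2 * ∫ ξ, negSymbol lam ξ * P ξ) := by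
    rw [hint]
    have := hne 0 le_rfl
    simp only [sub_zero]
    positivity
  have := nonneg_of_mul_nonneg_right hpos Real.two_pi_pos
  linarith

theorem norm_sub_cutoff_sq {s : Set ℝ} (hs : MeasurableSet s)
    (a : Lp ℂ 2 (volume : Measure ℝ)) :
    ‖cutoff hs a - a‖ ^ 2 = (∫ x, ‖a x‖ ^ 2) - ∫ x in s, ‖a x‖ ^ 2 := by
  have hi : Integrable (fun x => ‖a x‖ ^ 2) := (Lp.memLp a).integrable_norm_pow two_ne_zero
  rw [norm_sq_L2, ← integral_indicator hs, ← integral_sub hi (hi.indicator hs)]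
  refine integral_congr_ae ?_
  filter_upwards [Lp.coeFn_sub (cutoff hs a) a, coeFn_cutoff hs a] with x h1 h2
  rw [h1, Pi.sub_apply, h2]
  by_cases h : x ∈ s <;> simp [h]

theorem tendsto_cutoff_Icc (a : Lp ℂ 2 (volume : Measure ℝ)) :
    Tendsto (fun n : ℕ => cutoff (measurableSet_Icc (a := -(n : ℝ)) (b := n)) a) atTop (𝓝 a) := by
  rw [tendsto_iff_norm_sub_tendsto_zero]
  have hi : Integrable (fun x => ‖a x‖ ^ 2) := (Lp.memLp a).integrable_norm_pow two_ne_zero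
  have hU : (⋃ n : ℕ, Set.Icc (-(n : ℝ)) n) = Set.univ := by
    refine Set.eq_univ_of_forall fun x => ?_
    obtain ⟨n, hn⟩ := exists_nat_ge |x|
    exact Set.mem_iUnion.2 ⟨n, abs_le.1 hn⟩
  have h := tendsto_setIntegral_of_monotone (μ := volume) (f := fun x => ‖a x‖ ^ 2)
    (s := fun n : ℕ => Set.Icc (-(n : ℝ)) n) (fun _ => measurableSet_Icc)
    (fun n m hnm => Set.Icc_subset_Icc (by simpa using hnm) (by simpa using hnm)) hi.integrableOn
  rw [hU, setIntegral_univ] at h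
  have h2 := (h.const_sub (∫ x, ‖a x‖ ^ 2)).sqrt
  rw [sub_self, Real.sqrt_zero] at h2
  refine h2.congr fun n => ?_
  rw [← norm_sub_cutoff_sq measurableSet_Icc, Real.sqrt_sq (norm_nonneg _)]

/-- The quadratic inequality excluding positive eigenvalues of the Lax operator. -/
theorem neg_two_mul_im_inner_negRes_le {lam : ℝ} (hlam : 0 < lam)
    (g b : Lp ℂ 2 (volume : Measure ℝ)) (hb : b =ᵐ[volume] fun x : ℝ => (x : ℂ) * g x) :
    -2 * (inner ℂ (negRes hlam g) b).im ≤ ‖negRes hlam g‖ ^ 2 := by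
  -- Truncation to `[-n, n]` makes both functions integrable, as the previous lemma requires; both
  -- sides are continuous for the `L²` norm.
  have hcont : ∀ n : ℕ, -2 * (inner ℂ
      (negRes hlam (cutoff (measurableSet_Icc (a := -(n : ℝ)) (b := n)) g))
      (cutoff (measurableSet_Icc (a := -(n : ℝ)) (b := n)) b)).im ≤
      ‖negRes hlam (cutoff (measurableSet_Icc (a := -(n : ℝ)) (b := n)) g)‖ ^ 2 := by
    intro n
    set s := Set.Icc (-(n : ℝ)) n
    have hs : MeasurableSet s := measurableSet_Icc
    have h2 : MemLp (s.indicator g) 2 := (Lp.memLp g).indicator hs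
    have h4' : MemLp (s.indicator b) 2 := (Lp.memLp b).indicator hs
    have e : s.indicator b =ᵐ[volume] fun x : ℝ => (x : ℂ) * s.indicator g x := by
      filter_upwards [hb] with x hx
      by_cases h : x ∈ s <;> simp [h, hx]
    have h4 : MemLp (fun x : ℝ => (x : ℂ) * s.indicator g x) 2 := h4'.ae_eq e
    have fin : ∀ a : Lp ℂ 2 (volume : Measure ℝ), Integrable (s.indicator a) := fun a => by
      rw [integrable_indicator_iff hs]
      exact (locallyIntegrable_Lp_two a).integrableOn_isCompact isCompact_Icc
    have := neg_two_mul_im_inner_negRes_le_aux hlam (fin g) h2 ((fin b).congr e) h4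
    have e4 : h4.toLp _ = cutoff hs b := by
      apply Lp.ext
      exact h4.coeFn_toLp.trans (e.symm.trans (coeFn_cutoff hs b).symm)
    rw [e4] at this
    exact this
  have t1 := (negRes hlam).continuous.tendsto g |>.comp (tendsto_cutoff_Icc g)
  have t2 := tendsto_cutoff_Icc b
  exact le_of_tendsto_of_tendsto' ((Complex.continuous_im.tendsto _ |>.comp (t1.inner t2)).const_mul
    (-2)) (t1.norm.pow 2) hcont

/-- Conservation of the modulus between the two ends of the line: if `∫ g conj(m)` is real, where
`m` is the solution of the Jost equation with amplitude `c` at `-∞`, then the amplitude at `+∞`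
has the same modulus. -/
theorem norm_amplitude_atTop {lam : ℝ} (hlam : 0 < lam) (c : ℂ)
    (g : Lp ℂ 2 (volume : Measure ℝ)) (hg : Integrable g)
    (hreal : ∀ᵐ x, (g x * star (jost hlam c g x)).im = 0) :
    ‖c + ∫ y, Complex.I * (wave (-lam) y * g y)‖ = ‖c‖ := by
  set a := amplitude lam c g with ha
  set L := c + ∫ y, Complex.I * (wave (-lam) y * g y) with hL
  have hP := isPrimitive_amplitude (lam := lam) hg c
  have hPP := hP.mul hP.conj
  set V : ℝ → ℂ := fun x => wave lam x * a x with hV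
  have cV : Continuous V := (continuous_wave lam).mul (continuous_amplitude hg c)
  have iV : Integrable (fun x => g x * star (V x)) :=
    hg.mul_bdd (c := ‖c‖ + ∫ y, ‖g y‖) cV.star.aestronglyMeasurable
      (Eventually.of_forall fun x => by
        rw [norm_star, hV, norm_mul, norm_wave, one_mul]; exact norm_amplitude_le hg c x)
  have iN : Integrable (fun x => g x * star (negResFun hlam g x)) :=
    hg.mul_bdd (c := ‖negKernel hlam 0‖ * ‖g‖)
      (continuous_negResFun hlam g).star.aestronglyMeasurable
      (Eventually.of_forall fun x => by
        rw [norm_star]; exact norm_negResFun_le hlam g x)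
  have eN : (∫ x, g x * star (negResFun hlam g x)).im = 0 := by
    rw [← im_inner_negRes_self hlam g, L2.inner_def]
    congr 1
    refine integral_congr_ae ?_
    filter_upwards [negRes_ae_eq hlam g] with x hx
    rw [hx]
    rfl
  -- `V` is the Jost solution minus its resolvent part, and each of these contributes a real
  -- integral.
  have eV : (∫ x, g x * star (V x)).im = 0 := by
    have h1 : (∫ x, g x * star (V x)) + ∫ x, g x * star (negResFun hlam g x) =
        ∫ x, g x * star (jost hlam c g x) := by
      rw [← integral_add iV iN]
      refine integral_congr_ae (Eventually.of_forall fun x => ?_)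
      simp only [jost, hV, ha, star_add]
      ring
    have h2 : (∫ x, g x * star (jost hlam c g x)).im = 0 := by
      have hi : Integrable (fun x => g x * star (jost hlam c g x)) :=
        (iV.add iN).congr (Eventually.of_forall fun x => by
          simp only [jost, hV, ha, star_add, Pi.add_apply]; ring)
      have := integral_im (𝕜 := ℂ) hi
      refine this.symm.trans (integral_eq_zero_of_ae ?_)
      filter_upwards [hreal] with x hx using hx
    have h3 := congrArg Complex.im h1
    rw [Complex.add_im, eN, add_zero, h2] at h3
    exact h3
  have hpt : ∀ x, Complex.I * (wave (-lam) x * g x) * star (a x) +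
      a x * star (Complex.I * (wave (-lam) x * g x)) =
      Complex.I * (g x * star (V x)) + star (Complex.I * (g x * star (V x))) := by
    intro x
    simp only [hV, star_mul', star_star, star_wave, neg_neg]
    ring
  have iI := iV.const_mul Complex.I
  have iI' : Integrable (fun x => star (Complex.I * (g x * star (V x)))) :=
    (Complex.conjCLE : ℂ →L[ℝ] ℂ).integrable_comp iI
  have hint := hPP.integral_eq_of_tendsto
    ((iI.add iI').congr (Eventually.of_forall fun x => (hpt x).symm))
    ((tendsto_amplitude_atBot hg c).mul (tendsto_amplitude_atBot hg c).star)
    ((tendsto_amplitude_atTop hg c).mul (tendsto_amplitude_atTop hg c).star)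
  have hz : ∫ x, (Complex.I * (g x * star (V x)) + star (Complex.I * (g x * star (V x)))) = 0 := by
    rw [integral_add iI iI']
    have h1 : ∫ x, star (Complex.I * (g x * star (V x))) =
        star (∫ x, Complex.I * (g x * star (V x))) := integral_conj
    rw [h1, integral_const_mul]
    generalize (∫ x, g x * star (V x)) = X at eV
    apply Complex.ext <;> simp [eV]
  rw [← ha] at hint
  simp only [hpt] at hint
  rw [hz, ← hL, Complex.star_def, Complex.mul_conj', Complex.mul_conj'] at hint
  have h4 : ‖L‖ ^ 2 = ‖c‖ ^ 2 := by
    have := sub_eq_zero.1 hint.symm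
    exact_mod_cast this
  exact (pow_left_inj₀ (norm_nonneg _) (norm_nonneg _) two_ne_zero).1 h4

/-! ### Decay and square integrability of primitives of weighted `L²` functions. -/

theorem mul_sq_integral_Ioi_le {h : ℝ → ℝ} (h0 : ∀ x, 0 ≤ h x) (hi : Integrable h)
    (hx : MemLp (fun x => x * h x) 2) {x : ℝ} (hx0 : 0 < x) :
    x * (∫ y in Set.Ioi x, h y) ^ 2 ≤ ∫ y in Set.Ioi x, (y * h y) ^ 2 := by
  have i2 : Integrable (fun y => (y * h y) ^ 2) := hx.integrable_sq
  have iinv : IntegrableOn (fun y : ℝ => y ^ (-2 : ℝ)) (Set.Ioi x) :=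
    integrableOn_Ioi_rpow_of_lt (by norm_num) hx0
  have vinv : ∫ y in Set.Ioi x, y ^ (-2 : ℝ) = x⁻¹ := by
    rw [integral_Ioi_rpow_of_lt (by norm_num) hx0]
    norm_num
    rw [Real.rpow_neg_one]
  set T := ∫ y in Set.Ioi x, (y * h y) ^ 2
  set A := ∫ y in Set.Ioi x, h y
  have hT : 0 ≤ T := integral_nonneg fun y => sq_nonneg _
  have hA : 0 ≤ A := integral_nonneg fun y => h0 y
  -- `2 t h ≤ (y h)² + t² y⁻²` for every `t`
  have key : ∀ t : ℝ, 2 * t * A ≤ T + t ^ 2 * x⁻¹ := by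
    intro t
    rw [← vinv, ← integral_const_mul, ← integral_const_mul,
      ← integral_add i2.integrableOn (iinv.const_mul _)]
    refine setIntegral_mono_on (hi.const_mul _).integrableOn
      (i2.integrableOn.add (iinv.const_mul _)) measurableSet_Ioi fun y hy => ?_
    have hy0 : 0 < y := hx0.trans hy
    rw [Real.rpow_neg hy0.le, Real.rpow_ofNat]
    have e : (y * h y) ^ 2 + t ^ 2 * (y ^ 2)⁻¹ - 2 * t * h y = (y * h y - t * y⁻¹) ^ 2 := by
      field_simp
      ring
    nlinarith [sq_nonneg (y * h y - t * y⁻¹)]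
  -- The minimiser in `t` of `t² x⁻¹ - 2 t A`; this recovers Cauchy–Schwarz with weight `y⁻²`.
  have := key (x * A)
  have e : (x * A) ^ 2 * x⁻¹ = x * A ^ 2 := by field_simp
  rw [e] at this
  nlinarith

theorem tendsto_integral_Ioi_atTop {h : ℝ → ℝ} (hi : Integrable h) :
    Tendsto (fun x => ∫ y in Set.Ioi x, h y) atTop (𝓝 0) := by
  have h1 := tendsto_setIntegral_of_monotone (μ := volume) (f := h) (s := fun x : ℝ => Set.Iic x)
    (fun _ => measurableSet_Iic) (fun _ _ h => Set.Iic_subset_Iic.2 h) hi.integrableOn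
  rw [Set.iUnion_Iic, setIntegral_univ] at h1
  have h2 := h1.const_sub (∫ y, h y)
  rw [sub_self] at h2
  refine h2.congr fun x => ?_
  rw [← Set.compl_Iic, ← integral_add_compl measurableSet_Iic hi]
  ring

theorem tendsto_mul_sq_integral_Ioi {h : ℝ → ℝ} (h0 : ∀ x, 0 ≤ h x) (hi : Integrable h)
    (hx : MemLp (fun x => x * h x) 2) :
    Tendsto (fun x => x * (∫ y in Set.Ioi x, h y) ^ 2) atTop (𝓝 0) := by
  have i2 : Integrable (fun y => (y * h y) ^ 2) := hx.integrable_sq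
  refine squeeze_zero' ?_ ?_ (tendsto_integral_Ioi_atTop i2)
  · filter_upwards [eventually_gt_atTop 0] with x hx0
    positivity
  · filter_upwards [eventually_gt_atTop 0] with x hx0
    exact mul_sq_integral_Ioi_le h0 hi hx hx0

section decay

variable {a a' : ℝ → ℂ}

/-- As `a` vanishes at `+∞`, `|a(x)|` is at most the tail integral of `|a'|`. This kills the
boundary terms when `(x |a|²)'` is integrated. -/
theorem tendsto_mul_norm_sq_atTop (hP : IsPrimitive a a') (hi : Integrable a')
    (hx : MemLp (fun x : ℝ => (x : ℂ) * a' x) 2) (ht : Tendsto a atTop (𝓝 0)) :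
    Tendsto (fun x => x * ‖a x‖ ^ 2) atTop (𝓝 0) := by
  have hx' : MemLp (fun x => x * ‖a' x‖) 2 := by
    refine hx.norm.congr_norm ?_ (Eventually.of_forall fun x => by simp)
    exact (continuous_id.aestronglyMeasurable).mul hi.norm.aestronglyMeasurable
  refine squeeze_zero' ?_ ?_ (tendsto_mul_sq_integral_Ioi (fun x => norm_nonneg (a' x)) hi.norm hx')
  · filter_upwards [eventually_ge_atTop 0] with x hx0
    positivity
  · filter_upwards [eventually_ge_atTop 0] with x hx0
    have h1 := intervalIntegral_tendsto_integral_Ioi x hi.integrableOn (tendsto_id (α := ℝ))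
    have h2 : Tendsto (fun b => ∫ y in x..id b, a' y) atTop (𝓝 (0 - a x)) := by
      simp only [hP.integral_eq]
      exact ht.sub_const _
    have h3 : ‖a x‖ ≤ ∫ y in Set.Ioi x, ‖a' y‖ := by
      have h4 := tendsto_nhds_unique h2 h1
      rw [zero_sub] at h4
      rw [← norm_neg, h4]
      exact norm_integral_le_integral_norm _
    gcongr

theorem IsPrimitive.comp_neg (hP : IsPrimitive a a') (hi : Integrable a') :
    IsPrimitive (fun x => a (-x)) (fun x => -a' (-x)) := by
  refine ⟨hi.comp_neg.neg.locallyIntegrable, fun b c => ?_⟩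
  rw [intervalIntegral.integral_neg, intervalIntegral.integral_comp_neg, hP.integral_eq]
  ring

theorem tendsto_mul_norm_sq_atBot (hP : IsPrimitive a a') (hi : Integrable a')
    (hx : MemLp (fun x : ℝ => (x : ℂ) * a' x) 2) (ht : Tendsto a atBot (𝓝 0)) :
    Tendsto (fun x => x * ‖a x‖ ^ 2) atBot (𝓝 0) := by
  have h := tendsto_mul_norm_sq_atTop (hP.comp_neg hi) hi.comp_neg.neg (by
    have h := hx.comp_measurePreserving (Measure.measurePreserving_neg (volume : Measure ℝ))
    refine h.ae_eq (Eventually.of_forall fun x => ?_)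
    simp) (ht.comp tendsto_neg_atTop_atBot)
  have h2 := (h.comp tendsto_neg_atBot_atTop).neg
  simpa using h2

/-- A primitive vanishing at both ends of a function `a'` with `x a' ∈ L²` is in `L²`, and its norm
is computed by integrating `(x |a|²)'`. -/
theorem integral_norm_sq_of_primitive (hP : IsPrimitive a a') (hi : Integrable a')
    (hx : MemLp (fun x : ℝ => (x : ℂ) * a' x) 2) (hT : Tendsto a atTop (𝓝 0))
    (hB : Tendsto a atBot (𝓝 0)) :
    MemLp a 2 ∧ ∫ x, ‖a x‖ ^ 2 = -2 * (∫ x : ℝ, (x : ℂ) * a' x * star (a x)).re := by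
  have ca := hP.continuous
  have tT := tendsto_mul_norm_sq_atTop hP hi hx hT
  have tB := tendsto_mul_norm_sq_atBot hP hi hx hB
  have hid : IsPrimitive (fun x : ℝ => (x : ℂ)) (fun _ => 1) :=
    IsPrimitive.of_hasDerivAt (fun x => (hasDerivAt_id x).ofReal_comp) continuous_const
  have hQ := hid.mul (hP.mul hP.conj)
  set d : ℝ → ℂ := fun x => 1 * (a x * star (a x)) + x * (a' x * star (a x) + a x * star (a' x))
    with hd
  have hdre : ∀ x, (d x).re = ‖a x‖ ^ 2 + 2 * ((x : ℂ) * a' x * star (a x)).re := by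
    intro x
    rw [hd, ← Complex.normSq_eq_norm_sq, Complex.normSq_apply]
    simp
    ring
  have hQre := hQ.re_primitive
  have hval : ∀ x : ℝ, ((x : ℂ) * (a x * star (a x))).re = x * ‖a x‖ ^ 2 := by
    intro x
    rw [← Complex.normSq_eq_norm_sq, Complex.normSq_apply]
    simp
  have ix2 : Integrable (fun x : ℝ => ‖(x : ℂ) * a' x‖ ^ 2) := hx.integrable_norm_pow two_ne_zero
  -- The cross term is absorbed by `2 |x a'| |a| ≤ |a|² / 2 + 2 |x a'|²`. The boundary terms on
  -- `[-R, R]` are eventually at most `1`, whence the bound `2 (1 + 2 ∫ |x a'|²)`.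
  have hL2 : Integrable (fun x => ‖a x‖ ^ 2) := by
    have tE : Tendsto (fun R : ℝ => R * ‖a R‖ ^ 2 - (-R) * ‖a (-R)‖ ^ 2) atTop (𝓝 (0 - 0)) :=
      tT.sub (tB.comp tendsto_neg_atTop_atBot)
    refine integrable_of_intervalIntegral_norm_bounded (l := atTop) (a := fun R : ℝ => -R)
      (b := fun R : ℝ => R) (2 * (1 + 2 * ∫ x : ℝ, ‖(x : ℂ) * a' x‖ ^ 2)) (fun R => ?_)
      tendsto_neg_atTop_atBot tendsto_id ?_
    · exact ((ca.norm.pow 2).integrableOn_Icc).mono_set Set.Ioc_subset_Icc_self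
    · rw [sub_self] at tE
      filter_upwards [tE.eventually_le_const one_pos, eventually_ge_atTop 0] with R hR hR0
      have hle : -R ≤ R := by linarith
      have e1 := hQre.2 (-R) R
      rw [hval, hval] at e1
      have iA : IntervalIntegrable (fun x => ‖a x‖ ^ 2) volume (-R) R :=
        (ca.norm.pow 2).intervalIntegrable _ _
      have iX : IntervalIntegrable (fun x : ℝ => ‖(x : ℂ) * a' x‖ ^ 2) volume (-R) R :=
        ix2.intervalIntegrable
      have e2 : ∫ x in (-R)..R, ((1 / 2 : ℝ) * ‖a x‖ ^ 2 - 2 * ‖(x : ℂ) * a' x‖ ^ 2) ≤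
          ∫ x in (-R)..R, (d x).re := by
        refine intervalIntegral.integral_mono_on hle ((iA.const_mul _).sub (iX.const_mul _))
          (intervalIntegrable_of_locallyIntegrable hQre.1 _ _) fun x _ => ?_
        rw [hdre]
        have h1 : -(‖(x : ℂ) * a' x‖ * ‖a x‖) ≤ ((x : ℂ) * a' x * star (a x)).re := by
          have := Complex.abs_re_le_norm ((x : ℂ) * a' x * star (a x))
          rw [norm_mul, norm_star] at this
          exact (abs_le.1 this).1
        nlinarith [sq_nonneg (‖a x‖ - 2 * ‖(x : ℂ) * a' x‖)]
      rw [intervalIntegral.integral_sub (iA.const_mul _) (iX.const_mul _),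
        intervalIntegral.integral_const_mul, intervalIntegral.integral_const_mul] at e2
      have e3 : ∫ x in (-R)..R, ‖(x : ℂ) * a' x‖ ^ 2 ≤ ∫ x : ℝ, ‖(x : ℂ) * a' x‖ ^ 2 := by
        rw [intervalIntegral.integral_of_le hle]
        exact setIntegral_le_integral ix2 (Eventually.of_forall fun x => sq_nonneg _)
      simp only [norm_pow, norm_norm]
      linarith
  have hmem : MemLp a 2 := (memLp_two_iff_integrable_sq_norm ca.aestronglyMeasurable).2 hL2
  refine ⟨hmem, ?_⟩
  have iXa : Integrable (fun x : ℝ => (x : ℂ) * a' x * star (a x)) :=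
    hx.integrable_mul hmem.star
  have iXr : Integrable (fun x : ℝ => ((x : ℂ) * a' x * star (a x)).re) := iXa.re
  have h1 := intervalIntegral_tendsto_integral (l := atTop) (hL2.add (iXr.const_mul 2))
    tendsto_neg_atTop_atBot (tendsto_id (α := ℝ))
  have h2 : Tendsto (fun R : ℝ => ∫ x in (-R)..R, (‖a x‖ ^ 2 + 2 * ((x : ℂ) * a' x * star (a x)).re))
      atTop (𝓝 (0 - 0)) := by
    refine (tT.sub (tB.comp tendsto_neg_atTop_atBot)).congr fun R => ?_
    have e1 := hQre.2 (-R) R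
    rw [hval, hval] at e1
    simp only [← hdre]
    rw [e1]
    rfl
  have h3 := tendsto_nhds_unique h1 h2
  rw [integral_add' hL2 (iXr.const_mul 2), integral_const_mul, sub_self] at h3
  have h4 : ∫ x : ℝ, ((x : ℂ) * a' x * star (a x)).re =
      (∫ x : ℝ, (x : ℂ) * a' x * star (a x)).re := integral_re iXa
  rw [h4] at h3
  linarith

end decay

/-! ### Uniqueness for the Jost equation. -/

/-- The inclusions of `L²` and of `L^∞` in the distributions are compatible, and so are the
corresponding Hardy spaces. -/
theorem mem_hardy_two_of_ae_eq {F : Lp ℂ 2 (volume : Measure ℝ)} {m : Lp ℂ ∞ (volume : Measure ℝ)}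
    (h : F =ᵐ[volume] m) (hm : m ∈ hardy ∞) : F ∈ hardy 2 := by
  intro φ hφ
  have := hm φ hφ
  rw [TemperedDistribution.fourier_apply, Lp.toTemperedDistribution_apply] at this ⊢
  rw [← this]
  refine integral_congr_ae ?_
  filter_upwards [h] with x hx
  rw [hx]

theorem inner_negRes_of_mem_hardy {lam : ℝ} (hlam : 0 < lam) {F : Lp ℂ 2 (volume : Measure ℝ)}
    (hF : F ∈ hardy 2) (g : Lp ℂ 2 (volume : Measure ℝ)) : inner ℂ F (negRes hlam g) = 0 := by
  rw [mem_hardy_two_iff] at hF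
  rw [← Lp.inner_fourier_eq]
  refine inner_eq_zero_of_ae ?_
  filter_upwards [hF, fourier_negRes hlam g] with ξ h1 h2
  by_cases h : ξ < 0
  · exact Or.inl (h1 h)
  · right
    rw [h2, negSymbol, if_neg h]
    simp

/-- A solution of the Jost equation vanishing at both ends of the line is zero. -/
theorem jost_eq_zero {lam : ℝ} (hlam : 0 < lam) (g : Lp ℂ 2 (volume : Measure ℝ))
    (hg : Integrable g) (hxg : MemLp (fun x : ℝ => (x : ℂ) * g x) 2)
    (hreal : ∀ᵐ x, (g x * star (jost hlam 0 g x)).im = 0)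
    (hend : ∫ y, Complex.I * (wave (-lam) y * g y) = 0) : jost hlam 0 g = 0 := by
  set a := amplitude lam 0 g with ha
  have hP : IsPrimitive a _ := isPrimitive_amplitude (lam := lam) hg 0
  have hT : Tendsto a atTop (𝓝 0) := by
    simpa [hend] using tendsto_amplitude_atTop (lam := lam) hg 0
  have hB : Tendsto a atBot (𝓝 0) := tendsto_amplitude_atBot (lam := lam) hg 0
  have hxa : MemLp (fun x : ℝ => (x : ℂ) * (Complex.I * (wave (-lam) x * g x))) 2 := by
    refine hxg.congr_norm ?_ (Eventually.of_forall fun x => by simp)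
    exact (Complex.continuous_ofReal.aestronglyMeasurable).mul (integrable_I_wave hg).1
  obtain ⟨ma, ea⟩ := integral_norm_sq_of_primitive hP (integrable_I_wave hg) hxa hT hB
  set V : ℝ → ℂ := fun x => wave lam x * a x with hV
  have cV : Continuous V := (continuous_wave lam).mul hP.continuous
  have mV : MemLp V 2 :=
    ma.congr_norm cV.aestronglyMeasurable (Eventually.of_forall fun x => by simp [hV])
  set Vl : Lp ℂ 2 (volume : Measure ℝ) := mV.toLp V with hVl
  set N := negRes hlam g with hN
  set F : Lp ℂ 2 (volume : Measure ℝ) := Vl + N with hF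
  have eF : F =ᵐ[volume] jost hlam 0 g := by
    filter_upwards [Lp.coeFn_add Vl N, mV.coeFn_toLp, negRes_ae_eq hlam g] with x h1 h2 h3
    rw [hF, h1, Pi.add_apply, hVl, h2, hN, h3]
    rfl
  have mj := memLp_top_jost hlam 0 g hg
  have hFh : F ∈ hardy 2 := mem_hardy_two_of_ae_eq (eF.trans mj.coeFn_toLp.symm)
    (mem_hardy_top_of_ae_eq_jost hlam 0 g hg _ mj.coeFn_toLp)
  have horth : inner ℂ F N = 0 := inner_negRes_of_mem_hardy hlam hFh g
  set b : Lp ℂ 2 (volume : Measure ℝ) := hxg.toLp _ with hb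
  have ebx : b =ᵐ[volume] fun x : ℝ => (x : ℂ) * g x := hxg.coeFn_toLp
  have hineq := neg_two_mul_im_inner_negRes_le hlam g b ebx
  have nV : ‖Vl‖ ^ 2 = 2 * (inner ℂ Vl b).im := by
    rw [norm_sq_L2]
    have e1 : ∫ x, ‖Vl x‖ ^ 2 = ∫ x, ‖a x‖ ^ 2 := by
      refine integral_congr_ae ?_
      filter_upwards [mV.coeFn_toLp] with x hx
      rw [hVl, hx, hV, norm_mul, norm_wave, one_mul]
    have e2 : ∫ x : ℝ, (x : ℂ) * (Complex.I * (wave (-lam) x * g x)) * star (a x) =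
        Complex.I * inner ℂ Vl b := by
      rw [L2.inner_def, ← integral_const_mul]
      refine integral_congr_ae ?_
      filter_upwards [mV.coeFn_toLp, ebx] with x h1 h2
      rw [hVl, h1, h2]
      simp only [hV, RCLike.inner_apply, ← Complex.star_def, star_mul', star_wave]
      ring
    rw [e1, ea, e2]
    simp
  -- The integrand of `⟨F, x g⟩` is `x` times `g conj(F)`, which is real by hypothesis.
  have hsum : (inner ℂ Vl b).im + (inner ℂ N b).im = 0 := by
    rw [← Complex.add_im, ← inner_add_left, ← hF, L2.inner_def]
    have hi : Integrable (fun x => inner ℂ (F x) (b x)) := L2.integrable_inner F b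
    have := integral_im (𝕜 := ℂ) hi
    refine this.symm.trans (integral_eq_zero_of_ae ?_)
    filter_upwards [eF, ebx, hreal] with x h1 h2 h3
    rw [h1, h2, RCLike.inner_apply, mul_assoc]
    change ((x : ℂ) * (g x * star (jost hlam 0 g x))).im = 0
    rw [Complex.im_ofReal_mul, h3, mul_zero]
  have hpyth : ‖Vl‖ ^ 2 = ‖F‖ ^ 2 + ‖N‖ ^ 2 := by
    have e : Vl = F - N := by rw [hF, add_sub_cancel_right]
    rw [e, norm_sub_sq (𝕜 := ℂ), horth]
    simp
  -- `‖F‖² + ‖N‖² = ‖V‖² = -2 Im ⟨N, b⟩ ≤ ‖N‖²`.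
  have hF0 : F = 0 := by
    have : ‖F‖ ^ 2 ≤ 0 := by linarith
    exact norm_eq_zero.1 (pow_eq_zero_iff two_ne_zero |>.1 (le_antisymm this (sq_nonneg _)))
  refine (continuous_jost hlam 0 g hg).ae_eq_iff_eq volume continuous_zero |>.1 ?_
  rw [hF0] at eF
  exact eF.symm.trans (Lp.coeFn_zero _ _ _)

/-! ### Compactness and existence of the Jost solution. -/

/-- The operator `h ↦ (x ↦ Q x h)` defined by a square-integrable family `Q` of functionals. -/
noncomputable def hilbertSchmidt {Y : Type*} [NormedAddCommGroup Y] [NormedSpace ℂ Y] :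
    Lp (Y →L[ℂ] ℂ) 2 (volume : Measure ℝ) →L[ℂ] Y →L[ℂ] Lp ℂ 2 (volume : Measure ℝ) :=
  ((ContinuousLinearMap.apply ℂ ℂ (E := Y)).compLpL₂ 2 volume).flip

theorem hilbertSchmidt_ae_eq {Y : Type*} [NormedAddCommGroup Y] [NormedSpace ℂ Y]
    (Q : Lp (Y →L[ℂ] ℂ) 2 (volume : Measure ℝ)) (h : Y) :
    hilbertSchmidt Q h =ᵐ[volume] fun x => Q x h :=
  (ContinuousLinearMap.apply ℂ ℂ h).coeFn_compLp Q

/-- For an indicator family `1_s c` the operator is `h ↦ c(h) 1_s`, of rank at most one. Sums of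
such families are dense in `L²`, the operator depends continuously on the family, and compact
operators form a closed set. -/
theorem isCompactOperator_hilbertSchmidt {Y : Type*} [NormedAddCommGroup Y] [NormedSpace ℂ Y]
    (Q : Lp (Y →L[ℂ] ℂ) 2 (volume : Measure ℝ)) : IsCompactOperator (hilbertSchmidt Q) := by
  refine Lp.induction ENNReal.ofNat_ne_top
    (motive := fun Q => IsCompactOperator (hilbertSchmidt (Y := Y) Q)) ?_ ?_ ?_ Q
  · intro c s hs hμs
    have hc : IsCompactOperator c := (isCompactOperator_id (E := ℂ)).comp_clm c
    have hcomp := hc.clm_comp (ContinuousLinearMap.toSpanSingleton ℂ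
      (indicatorConstLp 2 hs hμs.ne (1 : ℂ)))
    have heq : (hilbertSchmidt ((Lp.simpleFunc.indicatorConst 2 hs hμs.ne c :
        Lp.simpleFunc (Y →L[ℂ] ℂ) 2 volume) : Lp (Y →L[ℂ] ℂ) 2 (volume : Measure ℝ)) :
        Y → Lp ℂ 2 (volume : Measure ℝ)) = ContinuousLinearMap.toSpanSingleton ℂ
          (indicatorConstLp 2 hs hμs.ne (1 : ℂ)) ∘ c := by
      funext h
      apply Lp.ext
      have e : ((Lp.simpleFunc.indicatorConst 2 hs hμs.ne c : Lp.simpleFunc (Y →L[ℂ] ℂ) 2 volume) :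
          Lp (Y →L[ℂ] ℂ) 2 (volume : Measure ℝ)) = indicatorConstLp 2 hs hμs.ne c :=
        Lp.simpleFunc.coe_indicatorConst hs hμs.ne c
      rw [e]
      filter_upwards [hilbertSchmidt_ae_eq (indicatorConstLp 2 hs hμs.ne c) h,
        indicatorConstLp_coeFn (p := 2) (hs := hs) (hμs := hμs.ne) (c := c),
        Lp.coeFn_smul (c h) (indicatorConstLp 2 hs hμs.ne (1 : ℂ)),
        indicatorConstLp_coeFn (p := 2) (hs := hs) (hμs := hμs.ne) (c := (1 : ℂ))] with x h1 h2 h3 h4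
      rw [h1, h2, Function.comp_apply, ContinuousLinearMap.toSpanSingleton_apply, h3, Pi.smul_apply,
        h4]
      by_cases hx : x ∈ s <;> simp [hx]
    rw [heq]
    exact hcomp
  · intro f g hf hg _ h1 h2
    rw [map_add]
    exact h1.add h2
  · exact isClosed_setOfPred_isCompactOperator.preimage (hilbertSchmidt (Y := Y)).continuous

/-- The weight `(1 + x²)^(-1/2)`. -/
noncomputable def weight (x : ℝ) : ℝ := (√(1 + x ^ 2))⁻¹

theorem continuous_weight : Continuous weight := by
  unfold weight
  exact Continuous.inv₀ (by fun_prop) fun x => (Real.sqrt_pos.2 (by positivity)).ne'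

theorem weight_pos (x : ℝ) : 0 < weight x := inv_pos.2 (Real.sqrt_pos.2 (by positivity))

theorem weight_sq (x : ℝ) : weight x ^ 2 = (1 + x ^ 2)⁻¹ := by
  rw [weight, inv_pow, Real.sq_sqrt (by positivity)]

theorem weight_le_one (x : ℝ) : weight x ≤ 1 := by
  rw [weight]
  exact inv_le_one_of_one_le₀ (Real.one_le_sqrt.2 (by nlinarith [sq_nonneg x]))

theorem abs_mul_weight_le (x : ℝ) : |x| * weight x ≤ 1 := by
  rw [weight, ← div_eq_mul_inv, div_le_one (Real.sqrt_pos.2 (by positivity))]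
  exact Real.abs_le_sqrt (by linarith)

theorem memLp_two_weight : MemLp (fun x => (weight x : ℂ)) 2 := by
  have hm : AEStronglyMeasurable (fun x => (weight x : ℂ)) (volume : Measure ℝ) :=
    (Complex.continuous_ofReal.comp continuous_weight).aestronglyMeasurable
  rw [memLp_two_iff_integrable_sq_norm hm]
  refine integrable_inv_one_add_sq.congr (Eventually.of_forall fun x => ?_)
  simp [weight_sq]

theorem memLp_top_weight : MemLp (fun x => (weight x : ℂ)) ∞ :=
  memLp_top_of_bound (Complex.continuous_ofReal.comp continuous_weight).aestronglyMeasurable 1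
    (Eventually.of_forall fun x => by
      rw [Complex.norm_real, Real.norm_of_nonneg (weight_pos x).le]
      exact weight_le_one x)

/-- Multiplication by the weight on `L²`. -/
noncomputable def mulWeight : Lp ℂ 2 (volume : Measure ℝ) →L[ℂ] Lp ℂ 2 (volume : Measure ℝ) :=
  (ContinuousLinearMap.mul ℂ ℂ).holderL volume ∞ 2 2 (memLp_top_weight.toLp _)

theorem mulWeight_ae_eq (h : Lp ℂ 2 (volume : Measure ℝ)) :
    mulWeight h =ᵐ[volume] fun x => (weight x : ℂ) * h x := by
  filter_upwards [(ContinuousLinearMap.mul ℂ ℂ).coeFn_holder (r := 2)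
    (memLp_top_weight.toLp _) h, memLp_top_weight.coeFn_toLp] with x h1 h2
  refine h1.trans ?_
  rw [h2]
  rfl

theorem integrable_mulWeight (h : Lp ℂ 2 (volume : Measure ℝ)) : Integrable (mulWeight h) := by
  have := memLp_two_weight.integrable_mul (Lp.memLp h)
  exact this.congr (mulWeight_ae_eq h).symm

theorem memLp_id_mul_mulWeight (h : Lp ℂ 2 (volume : Measure ℝ)) :
    MemLp (fun x : ℝ => (x : ℂ) * mulWeight h x) 2 := by
  refine MemLp.of_le (Lp.memLp h) ((Complex.continuous_ofReal.aestronglyMeasurable).mul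
    (Lp.aestronglyMeasurable _)) ?_
  filter_upwards [mulWeight_ae_eq h] with x hx
  rw [hx, ← mul_assoc, norm_mul, norm_mul, Complex.norm_real, Complex.norm_real,
    Real.norm_eq_abs, Real.norm_of_nonneg (weight_pos x).le]
  exact mul_le_of_le_one_left (norm_nonneg _) (abs_mul_weight_le x)

theorem continuous_cutoff_Iic (v : Lp ℂ 2 (volume : Measure ℝ)) :
    Continuous fun x : ℝ => cutoff (measurableSet_Iic (a := x)) v := by
  have hi : Integrable (fun x => ‖v x‖ ^ 2) := (Lp.memLp v).integrable_norm_pow two_ne_zero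
  have key : ∀ x y : ℝ, ‖cutoff (measurableSet_Iic (a := x)) v -
      cutoff (measurableSet_Iic (a := y)) v‖ ^ 2 = |∫ t in y..x, ‖v t‖ ^ 2| := by
    have hle : ∀ x y : ℝ, y ≤ x → ‖cutoff (measurableSet_Iic (a := x)) v -
        cutoff (measurableSet_Iic (a := y)) v‖ ^ 2 = |∫ t in y..x, ‖v t‖ ^ 2| := by
      intro x y hxy
      rw [abs_of_nonneg (intervalIntegral.integral_nonneg hxy fun t _ => sq_nonneg _),
        intervalIntegral.integral_of_le hxy, norm_sq_L2, ← integral_indicator measurableSet_Ioc]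
      refine integral_congr_ae ?_
      filter_upwards [Lp.coeFn_sub (cutoff (measurableSet_Iic (a := x)) v)
        (cutoff (measurableSet_Iic (a := y)) v), coeFn_cutoff (measurableSet_Iic (a := x)) v,
        coeFn_cutoff (measurableSet_Iic (a := y)) v] with t h1 h2 h3
      rw [h1, Pi.sub_apply, h2, h3]
      by_cases hy : t ≤ y
      · simp [hy, hy.trans hxy]
      · by_cases hx : t ≤ x
        · simp [hx, hy, not_le.1 hy]
        · simp [hx, hy]
    intro x y
    rcases le_total y x with h | h
    · exact hle x y h
    · rw [norm_sub_rev, hle y x h, intervalIntegral.integral_symm, abs_neg]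
  rw [continuous_iff_continuousAt]
  intro y
  rw [ContinuousAt, tendsto_iff_norm_sub_tendsto_zero]
  have hc : Continuous fun x => √|∫ t in y..x, ‖v t‖ ^ 2| :=
    (intervalIntegral.continuous_primitive (fun _ _ => hi.intervalIntegrable) y).abs.sqrt
  have h0 := hc.tendsto y
  rw [intervalIntegral.integral_same, abs_zero, Real.sqrt_zero] at h0
  refine h0.congr fun x => ?_
  rw [← key, Real.sqrt_sq (norm_nonneg _)]

theorem norm_cutoff_le {s : Set ℝ} (hs : MeasurableSet s) (v : Lp ℂ 2 (volume : Measure ℝ)) :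
    ‖cutoff hs v‖ ≤ ‖v‖ := by
  refine Lp.norm_le_norm_of_ae_le ?_
  filter_upwards [coeFn_cutoff hs v] with x hx
  rw [hx]
  exact norm_indicator_le_norm_self _ _

/-- The function is the conjugate of the integration kernel `i exp (-i lam y) weight(y)`, because
the inner product is conjugate-linear in its first argument. -/
theorem memLp_phase (lam : ℝ) :
    MemLp (fun y => -Complex.I * (wave lam y * weight y)) 2 := by
  refine memLp_two_weight.congr_norm ?_ (Eventually.of_forall fun x => by simp)
  exact (continuous_const.mul ((continuous_wave lam).mul
    (Complex.continuous_ofReal.comp continuous_weight))).aestronglyMeasurable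

/-- The functional `h ↦ jost 0 (weight * h) x`. -/
noncomputable def jostFunctional {lam : ℝ} (hlam : 0 < lam) (x : ℝ) :
    Lp ℂ 2 (volume : Measure ℝ) →L[ℂ] ℂ :=
  wave lam x • innerSL ℂ (cutoff (measurableSet_Iic (a := x)) ((memLp_phase lam).toLp _)) +
    (innerSL ℂ (negKernel hlam x)) ∘L
      ((Lp.fourierTransformₗᵢ ℝ ℂ).toContinuousLinearEquiv.toContinuousLinearMap ∘L mulWeight)

theorem jostFunctional_apply {lam : ℝ} (hlam : 0 < lam) (x : ℝ)
    (h : Lp ℂ 2 (volume : Measure ℝ)) :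
    jostFunctional hlam x h = jost hlam 0 (mulWeight h) x := by
  have e1 : inner ℂ (cutoff (measurableSet_Iic (a := x)) ((memLp_phase lam).toLp _)) h =
      amplitude lam 0 (mulWeight h) x := by
    rw [amplitude, zero_add, L2.inner_def, ← integral_indicator measurableSet_Iic]
    refine integral_congr_ae ?_
    filter_upwards [coeFn_cutoff (measurableSet_Iic (a := x)) ((memLp_phase lam).toLp _),
      (memLp_phase lam).coeFn_toLp, mulWeight_ae_eq h] with y h1 h2 h3
    rw [h1]
    by_cases hy : y ∈ Set.Iic x
    · rw [Set.indicator_of_mem hy, Set.indicator_of_mem hy, h2, h3, RCLike.inner_apply]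
      simp only [← Complex.star_def, star_mul', star_wave, star_neg]
      simp
      ring
    · rw [Set.indicator_of_notMem hy, Set.indicator_of_notMem hy, inner_zero_left]
  rw [jost, ← e1]
  rfl

theorem continuous_jostFunctional {lam : ℝ} (hlam : 0 < lam) :
    Continuous (jostFunctional hlam) := by
  refine ((continuous_wave lam).smul ((innerSL ℂ).continuous.comp (continuous_cutoff_Iic _))).add ?_
  exact ((innerSL ℂ).continuous.comp (continuous_negKernel hlam)).clm_comp continuous_const

theorem exists_norm_jostFunctional_le {lam : ℝ} (hlam : 0 < lam) :
    ∃ C : ℝ, ∀ x, ‖jostFunctional hlam x‖ ≤ C := by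
  refine ⟨‖(memLp_phase lam).toLp _‖ + ‖negKernel hlam 0‖ * ‖((Lp.fourierTransformₗᵢ ℝ
    ℂ).toContinuousLinearEquiv.toContinuousLinearMap ∘L mulWeight)‖, fun x => ?_⟩
  refine (norm_add_le _ _).trans (add_le_add ?_ ?_)
  · rw [norm_smul, norm_wave, one_mul, innerSL_apply_norm]
    exact norm_cutoff_le _ _
  · refine (ContinuousLinearMap.opNorm_comp_le _ _).trans_eq ?_
    rw [innerSL_apply_norm, norm_negKernel]

theorem memLp_smul_jostFunctional {lam : ℝ} (hlam : 0 < lam) {ρ : ℝ → ℝ} (hρ : MemLp ρ 2) :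
    MemLp (fun x => (ρ x : ℂ) • jostFunctional hlam x) 2 := by
  obtain ⟨C, hC⟩ := exists_norm_jostFunctional_le hlam
  have h1 : MemLp (jostFunctional hlam) ∞ :=
    memLp_top_of_bound (continuous_jostFunctional hlam).aestronglyMeasurable C
      (Eventually.of_forall hC)
  exact h1.smul (p := 2) (r := 2) (hρ.ofReal (K := ℂ))

/-- Existence of the Jost solution: the Jost equation with amplitude `1` at `-∞` has a solution,
by the Fredholm alternative. -/
theorem exists_jost_solution {lam : ℝ} (hlam : 0 < lam) {ρ : ℝ → ℝ} (hρ : MemLp ρ 2) :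
    ∃ h : Lp ℂ 2 (volume : Measure ℝ),
      h =ᵐ[volume] fun x => (ρ x : ℂ) * jost hlam 1 (mulWeight h) x := by
  set B := hilbertSchmidt ((memLp_smul_jostFunctional hlam hρ).toLp _) with hB
  have hBe : ∀ h, B h =ᵐ[volume] fun x => (ρ x : ℂ) * jost hlam 0 (mulWeight h) x := by
    intro h
    filter_upwards [hilbertSchmidt_ae_eq ((memLp_smul_jostFunctional hlam hρ).toLp _) h,
      (memLp_smul_jostFunctional hlam hρ).coeFn_toLp] with x h1 h2
    rw [hB, h1, h2, ← jostFunctional_apply]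
    rfl
  -- An eigenvector `h` would give a Jost solution `j` with amplitude `0` and `g conj(j) = weight ρ
  -- |j|²` real; uniqueness makes `j`, hence `h = ρ j`, vanish.
  have hne : ¬ Module.End.HasEigenvalue (B : Module.End ℂ (Lp ℂ 2 (volume : Measure ℝ))) 1 := by
    intro hev
    obtain ⟨h, hh⟩ := hev.exists_hasEigenvector
    have hBh : B h = h := by simpa using hh.apply_eq_smul
    have e1 : h =ᵐ[volume] fun x => (ρ x : ℂ) * jost hlam 0 (mulWeight h) x := by
      have := hBe h
      rwa [hBh] at this
    have hreal : ∀ᵐ x, (mulWeight h x * star (jost hlam 0 (mulWeight h) x)).im = 0 := by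
      filter_upwards [e1, mulWeight_ae_eq h] with x h1 h2
      generalize jost hlam 0 (mulWeight h) x = j at h1
      rw [h2, h1, Complex.star_def, mul_assoc, mul_assoc, Complex.mul_conj, ← Complex.ofReal_mul,
        ← Complex.ofReal_mul, Complex.ofReal_im]
    have hi := integrable_mulWeight h
    have hend := norm_amplitude_atTop hlam 0 _ hi hreal
    rw [zero_add, norm_zero, norm_eq_zero] at hend
    have hz := jost_eq_zero hlam _ hi (memLp_id_mul_mulWeight h) hreal hend
    apply hh.2
    rw [Lp.eq_zero_iff_ae_eq_zero]
    filter_upwards [e1] with x h1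
    rw [h1, hz]
    simp
  have hres := (isCompactOperator_hilbertSchmidt
    ((memLp_smul_jostFunctional hlam hρ).toLp _)).hasEigenvalue_or_mem_resolventSet
    (one_ne_zero (α := ℂ)) |>.resolve_left hne
  rw [spectrum.mem_resolventSet_iff, map_one, ContinuousLinearMap.isUnit_iff_bijective] at hres
  have mw : MemLp (fun x => (ρ x : ℂ) * wave lam x) 2 := by
    refine hρ.ofReal (K := ℂ) |>.congr_norm ?_ (Eventually.of_forall fun x => by simp)
    exact hρ.ofReal.1.mul (continuous_wave lam).aestronglyMeasurable
  -- Solve `(1 - B) h = ρ exp (i lam x)`: the right-hand side is the contribution of the amplitude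
  -- `1`.
  obtain ⟨h, hh⟩ := hres.2 (mw.toLp _)
  refine ⟨h, ?_⟩
  have e2 : h = B h + mw.toLp _ := by
    rw [← hh]
    simp [hB]
  have e3 := Lp.coeFn_add (B h) (mw.toLp _)
  rw [← e2] at e3
  filter_upwards [e3, hBe h, mw.coeFn_toLp] with x h1 h2 h3
  rw [h1, Pi.add_apply, h2, h3, jost, jost, amplitude, amplitude]
  ring

/-! ### Asymptotics at the two ends of the line. -/

/-- The limits, along a filter, of the continuous representatives of the elements of a vector space
of bounded functions, multiplied by a fixed function, depend linearly on the element. -/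
theorem exists_linearMap_tendsto {V : Type*} [AddCommGroup V] [Module ℂ V]
    (J : V →ₗ[ℂ] Lp ℂ ∞ (volume : Measure ℝ)) {f : V → ℝ → ℂ} (hf : ∀ v, Continuous (f v))
    (hfJ : ∀ v, f v =ᵐ[volume] J v) (e : ℝ → ℂ) (l : Filter ℝ) [l.NeBot] {a : V → ℂ}
    (ha : ∀ v, Tendsto (fun x => f v x * e x) l (𝓝 (a v))) : ∃ L : V →ₗ[ℂ] ℂ, ∀ v, L v = a v := by
  have hadd : ∀ v w, f (v + w) = f v + f w := by
    intro v w
    refine ((hf _).ae_eq_iff_eq volume ((hf v).add (hf w))).1 ?_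
    have h := Lp.coeFn_add (J v) (J w)
    rw [← map_add] at h
    filter_upwards [hfJ (v + w), hfJ v, hfJ w, h] with x h1 h2 h3 h4
    rw [h1, h4, Pi.add_apply, Pi.add_apply, h2, h3]
  have hsmul : ∀ (c : ℂ) v, f (c • v) = c • f v := by
    intro c v
    refine ((hf _).ae_eq_iff_eq volume ((hf v).const_smul c)).1 ?_
    have h := Lp.coeFn_smul c (J v)
    rw [← map_smul] at h
    filter_upwards [hfJ (c • v), hfJ v, h] with x h1 h2 h3
    rw [h1, h3, Pi.smul_apply, Pi.smul_apply, h2]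
  refine ⟨{ toFun := a, map_add' := fun v w => ?_, map_smul' := fun c v => ?_ }, fun v => rfl⟩
  · refine tendsto_nhds_unique (ha (v + w)) (((ha v).add (ha w)).congr fun x => ?_)
    rw [hadd, Pi.add_apply, add_mul]
  · refine tendsto_nhds_unique (ha (c • v)) (((ha v).const_smul c).congr fun x => ?_)
    rw [hsmul, Pi.smul_apply, smul_eq_mul, smul_eq_mul, mul_assoc]

theorem tendsto_jost_mul_wave {lam : ℝ} (hlam : 0 < lam) (c : ℂ) (g : Lp ℂ 2 (volume : Measure ℝ))
    {l : Filter ℝ} (hl : l ≤ cocompact ℝ) {a : ℂ} (ha : Tendsto (amplitude lam c g) l (𝓝 a)) :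
    Tendsto (fun x => jost hlam c g x * wave (-lam) x) l (𝓝 a) := by
  have h1 : Tendsto (fun x => negResFun hlam g x * wave (-lam) x) l (𝓝 0) := by
    rw [tendsto_zero_iff_norm_tendsto_zero]
    simpa using ((tendsto_negResFun hlam g).mono_left hl).norm
  have h2 := ha.add h1
  rw [add_zero] at h2
  refine h2.congr fun x => ?_
  rw [jost, add_mul, mul_right_comm, wave_mul_wave_neg, one_mul]

/-! ### The generalised eigenspace of a symbol in the weighted space. -/

section symbol

variable {u : Lp ℝ 2 (volume : Measure ℝ)}

theorem ofReal_eq_weight_mul (u : ℝ → ℝ) (x : ℝ) :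
    (u x : ℂ) = weight x * (√(1 + x ^ 2) * u x : ℝ) := by
  rw [← Complex.ofReal_mul, weight, inv_mul_cancel_left₀ (Real.sqrt_pos.2 (by positivity)).ne']

theorem smul_ae_eq_mul (u : Lp ℝ 2 (volume : Measure ℝ)) (m : Lp ℂ ∞ (volume : Measure ℝ)) :
    (u • m : Lp ℂ 2 (volume : Measure ℝ)) =ᵐ[volume] fun x => (u x : ℂ) * m x := by
  filter_upwards [Lp.coeFn_lpSMul (r := 2) u m] with x hx
  rw [hx, Pi.smul_apply', Complex.real_smul]

/-- The product of a symbol in the weighted space and a bounded function lies in the range of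
multiplication by the weight. -/
theorem exists_mulWeight_eq_smul
    (hu : MemLp (fun x : ℝ => √(1 + x ^ 2) * u x) 2 (volume : Measure ℝ))
    (m : Lp ℂ ∞ (volume : Measure ℝ)) :
    ∃ h : Lp ℂ 2 (volume : Measure ℝ), mulWeight h = (u • m : Lp ℂ 2 (volume : Measure ℝ)) := by
  have hm : MemLp (fun x => (√(1 + x ^ 2) * u x : ℝ) * m x) 2 :=
    (Lp.memLp m).smul (p := 2) (r := 2) (q := ∞) (hu.ofReal (K := ℂ))
  refine ⟨hm.toLp _, Lp.ext ?_⟩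
  filter_upwards [mulWeight_ae_eq (hm.toLp _), hm.coeFn_toLp, smul_ae_eq_mul u m] with x h1 h2 h3
  rw [h1, h2, h3, ofReal_eq_weight_mul u, mul_assoc]

theorem integrable_smul (hu : MemLp (fun x : ℝ => √(1 + x ^ 2) * u x) 2 (volume : Measure ℝ))
    (m : Lp ℂ ∞ (volume : Measure ℝ)) : Integrable (u • m : Lp ℂ 2 (volume : Measure ℝ)) := by
  obtain ⟨h, hh⟩ := exists_mulWeight_eq_smul hu m
  exact hh ▸ integrable_mulWeight h

theorem memLp_id_mul_smul (hu : MemLp (fun x : ℝ => √(1 + x ^ 2) * u x) 2 (volume : Measure ℝ))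
    (m : Lp ℂ ∞ (volume : Measure ℝ)) :
    MemLp (fun x : ℝ => (x : ℂ) * (u • m : Lp ℂ 2 (volume : Measure ℝ)) x) 2 := by
  obtain ⟨h, hh⟩ := exists_mulWeight_eq_smul hu m
  exact hh ▸ memLp_id_mul_mulWeight h

theorem im_smul_mul_star_jost {lam : ℝ} (hlam : 0 < lam) {c : ℂ}
    {m : Lp ℂ ∞ (volume : Measure ℝ)}
    (hm : m =ᵐ[volume] jost hlam c (u • m : Lp ℂ 2 (volume : Measure ℝ))) :
    ∀ᵐ x, ((u • m : Lp ℂ 2 (volume : Measure ℝ)) x *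
      star (jost hlam c (u • m : Lp ℂ 2 (volume : Measure ℝ)) x)).im = 0 := by
  filter_upwards [hm, smul_ae_eq_mul u m] with x h1 h2
  rw [← h1, h2, Complex.star_def, mul_assoc, Complex.mul_conj, ← Complex.ofReal_mul,
    Complex.ofReal_im]

/-- A solution of the Jost equation with amplitude `0` at `-∞` vanishes. -/
theorem eq_zero_of_ae_eq_jost_zero {lam : ℝ} (hlam : 0 < lam)
    (hu : MemLp (fun x : ℝ => √(1 + x ^ 2) * u x) 2 (volume : Measure ℝ))
    {m : Lp ℂ ∞ (volume : Measure ℝ)}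
    (hm : m =ᵐ[volume] jost hlam 0 (u • m : Lp ℂ 2 (volume : Measure ℝ))) : m = 0 := by
  have hi := integrable_smul hu m
  have hr := im_smul_mul_star_jost hlam hm
  have hend := norm_amplitude_atTop hlam 0 _ hi hr
  rw [zero_add, norm_zero, norm_eq_zero] at hend
  rw [jost_eq_zero hlam _ hi (memLp_id_mul_smul hu m) hr hend] at hm
  rwa [Lp.eq_zero_iff_ae_eq_zero]

/-- There is a generalized eigenfunction with amplitude `1` at `-∞`. -/
theorem exists_mem_genEigenspace {lam : ℝ} (hlam : 0 < lam)
    (hu : MemLp (fun x : ℝ => √(1 + x ^ 2) * u x) 2 (volume : Measure ℝ)) :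
    ∃ m : hardy ∞, m ∈ genEigenspace u lam ∧ (m : Lp ℂ ∞ (volume : Measure ℝ)) =ᵐ[volume]
      jost hlam 1 (u • (m : Lp ℂ ∞ (volume : Measure ℝ)) : Lp ℂ 2 (volume : Measure ℝ)) := by
  obtain ⟨h, hh⟩ := exists_jost_solution hlam hu
  have hM := memLp_top_jost hlam 1 _ (integrable_mulWeight h)
  have hg : (u • hM.toLp _ : Lp ℂ 2 (volume : Measure ℝ)) = mulWeight h := by
    apply Lp.ext
    filter_upwards [smul_ae_eq_mul u (hM.toLp _), mulWeight_ae_eq h, hh, hM.coeFn_toLp]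
      with x h1 h2 h3 h4
    generalize jost hlam 1 (mulWeight h) x = j at h3 h4
    rw [h1, h2, h3, h4, ofReal_eq_weight_mul u, mul_assoc]
  have hjost : hM.toLp _ =ᵐ[volume]
      jost hlam 1 (u • hM.toLp _ : Lp ℂ 2 (volume : Measure ℝ)) := by
    rw [hg]
    exact hM.coeFn_toLp
  refine ⟨⟨hM.toLp _, mem_hardy_top_of_ae_eq_jost hlam 1 _ (integrable_mulWeight h) _
    hM.coeFn_toLp⟩, ?_, hjost⟩
  exact (mem_genEigenspace_iff u hlam _ (integrable_smul hu _)).2 ⟨1, hjost⟩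

end symbol

end BenjaminOno

open BenjaminOno in
theorem proposition7p3 (u : Lp ℝ 2 (volume : Measure ℝ))
    (hu : MemLp (fun x : ℝ => √(1 + x ^ 2) * u x) 2 (volume : Measure ℝ))
    (lam : ℝ) (hlam : 0 < lam) :
    Module.finrank ℂ (BenjaminOno.genEigenspace u lam) = 1 ∧
    ∃ ellPlus ellMinus : BenjaminOno.genEigenspace u lam →ₗ[ℂ] ℂ,
      (∀ m : BenjaminOno.genEigenspace u lam, ∃ f : ℝ → ℂ, Continuous f ∧
        f =ᵐ[volume] ((m : BenjaminOno.hardy ∞) : Lp ℂ ∞ (volume : Measure ℝ)) ∧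
        Tendsto (fun x : ℝ => f x * Complex.exp (-(Complex.I * lam * x))) atTop
          (𝓝 (ellPlus m)) ∧
        Tendsto (fun x : ℝ => f x * Complex.exp (-(Complex.I * lam * x))) atBot
          (𝓝 (ellMinus m))) ∧
      ellPlus ≠ 0 ∧ ellMinus ≠ 0 := by
  have hexp : ∀ x : ℝ, Complex.exp (-(Complex.I * lam * x)) = wave (-lam) x := fun x => by
    rw [wave, Complex.ofReal_neg, mul_neg, neg_mul]
  simp only [hexp]
  let J : genEigenspace u lam →ₗ[ℂ] Lp ℂ ∞ (volume : Measure ℝ) :=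
    (hardy ∞).subtype ∘ₗ (genEigenspace u lam).subtype
  let g : genEigenspace u lam → Lp ℂ 2 (volume : Measure ℝ) := fun m => u • J m
  have hg : ∀ m, Integrable (g m) := fun m => integrable_smul hu (J m)
  have hex : ∀ m : genEigenspace u lam, ∃ c : ℂ, J m =ᵐ[volume] jost hlam c (g m) :=
    fun m => (mem_genEigenspace_iff u hlam m (hg m)).1 m.2
  choose c hc using hex
  have hcont : ∀ m, Continuous (jost hlam (c m) (g m)) :=
    fun m => continuous_jost hlam _ _ (hg m)
  have hbot : ∀ m, Tendsto (fun x => jost hlam (c m) (g m) x * wave (-lam) x) atBot (𝓝 (c m)) :=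
    fun m => tendsto_jost_mul_wave hlam _ _ atBot_le_cocompact (tendsto_amplitude_atBot (hg m) _)
  have htop : ∀ m, Tendsto (fun x => jost hlam (c m) (g m) x * wave (-lam) x) atTop
      (𝓝 (c m + ∫ y, Complex.I * (wave (-lam) y * g m y))) :=
    fun m => tendsto_jost_mul_wave hlam _ _ atTop_le_cocompact (tendsto_amplitude_atTop (hg m) _)
  obtain ⟨ellMinus, hMinus⟩ := exists_linearMap_tendsto J hcont (fun m => (hc m).symm) _ atBot hbot
  obtain ⟨ellPlus, hPlus⟩ := exists_linearMap_tendsto J hcont (fun m => (hc m).symm) _ atTop htop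
  have hnorm : ∀ m, ‖ellPlus m‖ = ‖ellMinus m‖ := fun m => by
    rw [hPlus, hMinus]
    exact norm_amplitude_atTop hlam _ _ (hg m) (im_smul_mul_star_jost hlam (hc m))
  -- The limit at `-∞` is the amplitude `c`, so a zero limit is the uniqueness case.
  have hinj : Function.Injective ellMinus := by
    rw [injective_iff_map_eq_zero]
    intro m hm
    have h := hc m
    rw [← hMinus, hm] at h
    exact Subtype.ext (Subtype.ext (eq_zero_of_ae_eq_jost_zero hlam hu h))
  obtain ⟨m₀, hm₀, hjost⟩ := exists_mem_genEigenspace hlam hu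
  have hone : ellMinus ⟨m₀, hm₀⟩ = 1 := by
    rw [hMinus]
    -- The chosen amplitude `c` for `m₀` is not known to be `1` beforehand; the two continuous
    -- representatives coincide, and comparing limits at `-∞` identifies it.
    have heq := ((hcont ⟨m₀, hm₀⟩).ae_eq_iff_eq volume
      (continuous_jost hlam 1 _ (hg ⟨m₀, hm₀⟩))).1 ((hc ⟨m₀, hm₀⟩).symm.trans hjost)
    have h := hbot ⟨m₀, hm₀⟩
    rw [heq] at h
    exact tendsto_nhds_unique h (tendsto_jost_mul_wave hlam _ _ atBot_le_cocompact
      (tendsto_amplitude_atBot (hg ⟨m₀, hm₀⟩) _))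
  have hne : ellMinus ≠ 0 := fun h => by simp [h] at hone
  refine ⟨?_, ellPlus, ellMinus, fun m => ⟨_, hcont m, (hc m).symm, ?_, ?_⟩, ?_, hne⟩
  · rw [(LinearEquiv.ofBijective ellMinus ⟨hinj, LinearMap.surjective hne⟩).finrank_eq,
      Module.finrank_self]
  · exact hPlus m ▸ htop m
  · exact hMinus m ▸ hbot m
  · intro h
    have := hnorm ⟨m₀, hm₀⟩
    rw [h, hone] at this
    simp at this
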